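/- Let $E$ be a real Banach space with dual $E^*$ that is uniformly smooth (the limit $\lim_{t\to0}(\|x+ty\|-\|x\|)/t$ exists uniformly for unit vectors $x,y$) and 2-uniformly convex (there is $\kappa>0$ with $1-\|x+y\|/2\ge\kappa\|x-y\|^2$ for all unit vectors $x,y$). Let $J:E\to E^*$ be the normalized duality mapping, $\langle x,Jx\rangle=\|x\|^2=\|Jx\|^2$, let $\phi(x,y)=\|x\|^2-2\langle x,Jy\rangle+\|y\|^2$, and let $c$ be the largest number in $(0,1]$ with $\|x-y\|\le\frac{2}{c^2}\|Jx-Jy\|$ for all $x,y\in E$. For a nonempty closed convex set $D\subset E$, the generalized projection $\Pi_Dx$ is the minimizer of $\phi(y,x)$ over $y\in D$. Let $C\subset E$ be nonempty, closed and convex, and let $M,N,K\ge1$ be integers. - Let $\alpha>0$, and for $1\le i\le M$ let $A_i:C\to E^*$ satisfy: (V1) $\langle A_ix-A_iy,x-y\rangle\ge\alpha\|A_ix-A_iy\|^2$ for all $x,y\in C$; (V2) $VI(A_i,C)=\{p\in C:\langle A_ip,q-p\rangle\ge0\ \forall q\in C\}$ is nonempty; (V3) $\|A_iy\|\le\|A_iy-A_iu\|$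 for all $y\in C$, $u\in VI(A_i,C)$. - For $1\le l\le K$ let $f_l:C\times C\to\mathbb R$ satisfy: (A1) $f_l(x,x)=0$; (A2) $f_l(x,y)+f_l(y,x)\le0$; (A3) $\limsup_{t\to0^+}f_l(tz+(1-t)x,y)\le f_l(x,y)$; (A4) $f_l(x,\cdot)$ is convex and lower semicontinuous; for all $x,y,z\in C$. Put $EP(f_l)=\{p\in C:f_l(p,y)\ge0\ \forall y\in C\}$. - Let $L>0$ and let $(k_n)\subset[1,\infty)$ with $k_n\to1$. For $1\le j\le N$ let $S_j:C\to C$ have fixed point set $F(S_j)\neq\emptyset$ and satisfy $\|S_j^nx-S_j^ny\|\le L\|x-y\|$ and $\phi(p,S_j^nx)\le k_n\phi(p,x)$ for all $n\ge1$, $x,y\in C$, $p\in F(S_j)$. Let $F=\bigcap_iVI(A_i,C)\cap\bigcap_jF(S_j)\cap\bigcap_lEP(f_l)$ be nonempty, and let $\omega>0$ be such that $\|u\|\le\omega$ for all $u\in F$. Let $0\le\alpha_n\le1$, $\limsup_n\alpha_n<1$, $\lambda_n\in[a,b]$ for some $a,b\in(0,\alpha c^2/2)$, and $r_n\ge d$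 for some $d>0$. Given $x_0\in C$ and $C_0=C$, define for $n\ge0$ $$\begin{aligned} &y_n^i=\Pi_C\big(J^{-1}(Jx_n-\lambda_nA_ix_n)\big)\ (1\le i\le M),\quad \bar y_n=y_n^{i_n}\ \text{with } i_n\in\arg\max_i\|y_n^i-x_n\|,\\ &z_n^j=J^{-1}\big(\alpha_nJx_n+(1-\alpha_n)JS_j^n\bar y_n\big)\ (1\le j\le N),\quad \bar z_n=z_n^{j_n}\ \text{with } j_n\in\arg\max_j\|z_n^j-x_n\|,\\ &u_n^l\in C\ \text{with } f_l(u_n^l,y)+\tfrac1{r_n}\langle y-u_n^l,Ju_n^l-J\bar z_n\rangle\ge0\ \forall y\in C\ (1\le l\le K),\\ &\bar u_n=u_n^{l_n}\ \text{with } l_n\in\arg\max_l\|u_n^l-x_n\|,\\ &C_{n+1}=\{v\in C_n:\phi(v,\bar u_n)\le\phi(v,\bar z_n)\le\phi(v,x_n)+\epsilon_n\},\quad \epsilon_n=(k_n-1)(\omega+\|x_n\|)^2,\\ &x_{n+1}=\Pi_{C_{n+1}}x_0. \end{aligned}$$ Then this iteration can be carried out, the generalized projection $\Pi_Fx_0$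 exists and is unique, and every sequence $(x_n)$ so generated (for any choice of the maximizing indices) converges strongly to $\Pi_Fx_0$. -/

import Mathlib

open Filter Topology

noncomputable section

namespace HybridMethod

section Space

variable (E : Type*) [NormedAddCommGroup E] [NormedSpace ℝ E]

/-- `E` is uniformly smooth: the limit of `(‖x + t y‖ - ‖x‖) / t` as `t → 0` exists uniformly
for `x, y` in the unit sphere. -/
def UniformlySmooth : Prop :=
  ∃ G : E × E → ℝ,
    TendstoUniformlyOn (fun (t : ℝ) (p : E × E) => (‖p.1 + t • p.2‖ - ‖p.1‖) / t) G (𝓝[≠] (0 : ℝ))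
      (Metric.sphere (0 : E) 1 ×ˢ Metric.sphere (0 : E) 1)

/-- The modulus of convexity, the infimum of `1 - ‖x + y‖ / 2` over unit vectors `x, y` with
`‖x - y‖ = ε`. It is extended-real valued, so that the infimum of the empty set (which occurs
when `dim E ≤ 1`) is `⊤`. -/
def modulusOfConvexity (ε : ℝ) : EReal :=
  ⨅ (x : E) (y : E) (_ : ‖x‖ = 1) (_ : ‖y‖ = 1) (_ : ‖x - y‖ = ε), ((1 - ‖x + y‖ / 2 : ℝ) : EReal)

/-- `E` is 2-uniformly convex: `δ_E(ε) ≥ κ ε ^ 2` on `[0, 2]` for some constant `κ > 0`. -/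
def TwoUniformlyConvex : Prop :=
  ∃ κ : ℝ, 0 < κ ∧ ∀ ε ∈ Set.Icc (0 : ℝ) 2, ((κ * ε ^ 2 : ℝ) : EReal) ≤ modulusOfConvexity E ε

end Space

section Duality

variable {E : Type*} [NormedAddCommGroup E] [NormedSpace ℝ E]

/-- The (set-valued) normalized duality mapping. -/
def dualitySet (x : E) : Set (E →L[ℝ] ℝ) :=
  {ξ | ξ x = ‖x‖ ^ 2 ∧ ‖ξ‖ = ‖x‖}

theorem dualitySet_nonempty (x : E) : (dualitySet x).Nonempty := by
  obtain ⟨g, hg, hgx⟩ := exists_dual_vector'' ℝ x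
  have hgx' : g x = ‖x‖ := by simpa using hgx
  refine ⟨‖x‖ • g, ?_, ?_⟩
  · simp [hgx', sq]
  · rw [norm_smul, norm_norm]
    rcases eq_or_ne x 0 with rfl | hx
    · simp
    · have hx' : 0 < ‖x‖ := norm_pos_iff.mpr hx
      have h1 : ‖x‖ ≤ ‖g‖ * ‖x‖ := by
        have h2 := g.le_opNorm x
        rw [hgx', norm_norm] at h2
        exact h2
      have h3 : ‖g‖ = 1 := le_antisymm hg (by nlinarith)
      rw [h3, mul_one]

/-- The normalized duality mapping `J` as a function. In a smooth space, `dualitySet x` has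
exactly one element, which is `J x`. -/
def J (x : E) : E →L[ℝ] ℝ := (dualitySet_nonempty x).choose

theorem J_mem (x : E) : J x ∈ dualitySet x := (dualitySet_nonempty x).choose_spec

/-- The constants `c ∈ (0, 1]` with `‖x - y‖ ≤ (2 / c ^ 2) ‖J x - J y‖` for all `x, y`. -/
def convexityConstants (E : Type*) [NormedAddCommGroup E] [NormedSpace ℝ E] : Set ℝ :=
  {c | 0 < c ∧ c ≤ 1 ∧ ∀ x y : E, ‖x - y‖ ≤ 2 / c ^ 2 * ‖J x - J y‖}

/-- The best (largest) constant `c`; its inverse `1 / c` is the 2-uniform convexity constant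
of `E`. -/
def bestC (E : Type*) [NormedAddCommGroup E] [NormedSpace ℝ E] : ℝ :=
  sSup (convexityConstants E)

/-- The Lyapunov functional `φ(x, y) = ‖x‖² - 2⟨x, J y⟩ + ‖y‖²`. -/
def phi (x y : E) : ℝ := ‖x‖ ^ 2 - 2 * J y x + ‖y‖ ^ 2

/-- `p` is a generalized projection `Π_C x` of `x` onto `C`: a minimizer over `C` of `φ(·, x)`. -/
def IsGenProj (C : Set E) (x p : E) : Prop :=
  p ∈ C ∧ ∀ y ∈ C, phi p x ≤ phi y x

end Duality

section WellDefined

/-! The constant `bestC` is attained and positive in every 2-uniformly convex space. -/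

variable {E : Type*} [NormedAddCommGroup E] [NormedSpace ℝ E]

theorem TwoUniformlyConvex.unit_bound (h : TwoUniformlyConvex E) :
    ∃ κ : ℝ, 0 < κ ∧ ∀ u v : E, ‖u‖ = 1 → ‖v‖ = 1 → κ * ‖u - v‖ ^ 2 ≤ 1 - ‖u + v‖ / 2 := by
  obtain ⟨κ, hκ, h⟩ := h
  refine ⟨κ, hκ, fun u v hu hv => ?_⟩
  have h2 : ‖u - v‖ ≤ 2 := by
    have := norm_sub_le u v
    rw [hu, hv] at this
    linarith
  have h3 := h ‖u - v‖ ⟨norm_nonneg _, h2⟩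
  have h4 : modulusOfConvexity E ‖u - v‖ ≤ ((1 - ‖u + v‖ / 2 : ℝ) : EReal) :=
    iInf_le_of_le u (iInf_le_of_le v (iInf_le_of_le hu (iInf_le_of_le hv (iInf_le _ rfl))))
  exact_mod_cast h3.trans h4

theorem TwoUniformlyConvex.midpoint_bound (h : TwoUniformlyConvex E) :
    ∃ κ : ℝ, 0 < κ ∧ ∀ x y : E,
      ‖(1 / 2 : ℝ) • (x + y)‖ ^ 2 ≤ ‖x‖ ^ 2 / 2 + ‖y‖ ^ 2 / 2 - κ * ‖x - y‖ ^ 2 := by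
  obtain ⟨κ, hκ, h⟩ := h.unit_bound
  refine ⟨min (1 / 8) (κ / 2), by positivity, ?_⟩
  set μ := min (1 / 8) (κ / 2) with hμ
  have hμ1 : μ ≤ 1 / 8 := min_le_left _ _
  have hμ2 : μ ≤ κ / 2 := min_le_right _ _
  have hμ0 : 0 < μ := by positivity
  have key : ∀ x y : E, ‖y‖ ≤ ‖x‖ →
      ‖(1 / 2 : ℝ) • (x + y)‖ ^ 2 ≤ ‖x‖ ^ 2 / 2 + ‖y‖ ^ 2 / 2 - μ * ‖x - y‖ ^ 2 := by
    intro x y hxy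
    rcases eq_or_ne y 0 with rfl | hy
    · rw [add_zero, sub_zero, norm_smul, norm_zero]
      norm_num
      nlinarith [sq_nonneg ‖x‖]
    have hb : 0 < ‖y‖ := norm_pos_iff.mpr hy
    have ha : 0 < ‖x‖ := hb.trans_le hxy
    set a := ‖x‖ with ha'
    set b := ‖y‖ with hb'
    set u := a⁻¹ • x with hu
    set v := b⁻¹ • y with hv
    have hxu : x = a • u := by rw [hu, smul_smul, mul_inv_cancel₀ ha.ne', one_smul]
    have hyv : y = b • v := by rw [hv, smul_smul, mul_inv_cancel₀ hb.ne', one_smul]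
    have hun : ‖u‖ = 1 := by
      rw [hu, norm_smul, norm_inv, Real.norm_of_nonneg ha.le, ← ha', inv_mul_cancel₀ ha.ne']
    have hvn : ‖v‖ = 1 := by
      rw [hv, norm_smul, norm_inv, Real.norm_of_nonneg hb.le, ← hb', inv_mul_cancel₀ hb.ne']
    have h1 := h u v hun hvn
    set d := ‖u - v‖ with hd
    have hd0 : 0 ≤ d := norm_nonneg _
    have h2 : ‖(1 / 2 : ℝ) • (x + y)‖ ≤ (a + b) / 2 - b * (κ * d ^ 2) := by
      have e : (1 / 2 : ℝ) • (x + y) = (b / 2) • (u + v) + ((a - b) / 2) • u := by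
        rw [hxu, hyv]
        module
      rw [e]
      refine (norm_add_le _ _).trans ?_
      rw [norm_smul, norm_smul, hun, Real.norm_of_nonneg (by positivity : 0 ≤ b / 2),
        Real.norm_of_nonneg (by linarith : 0 ≤ (a - b) / 2)]
      nlinarith
    have h3 : ‖x - y‖ ≤ (a - b) + b * d := by
      have e : x - y = (a - b) • u + b • (u - v) := by
        rw [hxu, hyv]
        module
      rw [e]
      refine (norm_add_le _ _).trans ?_
      rw [norm_smul (a - b) u, norm_smul b (u - v), hun, Real.norm_of_nonneg hb.le,
        Real.norm_of_nonneg (by linarith : 0 ≤ a - b), mul_one]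
    have h4 : ‖x - y‖ ^ 2 ≤ 2 * (a - b) ^ 2 + 2 * (b * d) ^ 2 := by
      nlinarith [norm_nonneg (x - y), sq_nonneg ((a - b) - b * d)]
    have h5 : κ * d ^ 2 ≤ 1 := by linarith [norm_nonneg (u + v)]
    set s := κ * d ^ 2 with hs
    have hs0 : 0 ≤ s := by positivity
    have h6 : ‖(1 / 2 : ℝ) • (x + y)‖ ^ 2 ≤ ((a + b) / 2) ^ 2 - b ^ 2 * s := by
      have h7 : ‖(1 / 2 : ℝ) • (x + y)‖ ^ 2 ≤ ((a + b) / 2 - b * s) ^ 2 :=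
        pow_le_pow_left₀ (norm_nonneg _) h2 2
      have h8 : 0 ≤ b * s * (a - b) := by
        have : 0 ≤ a - b := by linarith
        positivity
      have h9 : 0 ≤ b ^ 2 * s * (1 - s) := by
        have : 0 ≤ 1 - s := by linarith
        positivity
      nlinarith
    have h10 : μ * ‖x - y‖ ^ 2 ≤ μ * (2 * (a - b) ^ 2 + 2 * (b * d) ^ 2) :=
      mul_le_mul_of_nonneg_left h4 hμ0.le
    have h11 : μ * (a - b) ^ 2 ≤ 1 / 8 * (a - b) ^ 2 :=
      mul_le_mul_of_nonneg_right hμ1 (sq_nonneg _)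
    have h12 : μ * (b * d) ^ 2 ≤ κ / 2 * (b * d) ^ 2 :=
      mul_le_mul_of_nonneg_right hμ2 (sq_nonneg _)
    have h13 : b ^ 2 * s = κ * (b * d) ^ 2 := by rw [hs]; ring
    nlinarith
  intro x y
  rcases le_total ‖y‖ ‖x‖ with hxy | hxy
  · exact key x y hxy
  · have := key y x hxy
    rw [add_comm y x, norm_sub_rev y x] at this
    linarith

theorem TwoUniformlyConvex.convexityConstants_nonempty (h : TwoUniformlyConvex E) :
    (convexityConstants E).Nonempty := by
  obtain ⟨κ, hκ, h⟩ := h.midpoint_bound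
  have sub : ∀ x z : E, ‖x‖ ^ 2 + 2 * J x (z - x) ≤ ‖z‖ ^ 2 := by
    intro x z
    obtain ⟨h1, h2⟩ := J_mem x
    have h3 : J x z ≤ ‖x‖ * ‖z‖ := by
      have := (le_abs_self _).trans ((J x).le_opNorm z)
      rwa [h2] at this
    rw [map_sub, h1]
    nlinarith [sq_nonneg (‖x‖ - ‖z‖)]
  have half : ∀ x y : E, J x (y - x) + κ * ‖x - y‖ ^ 2 ≤ ‖y‖ ^ 2 / 2 - ‖x‖ ^ 2 / 2 := by
    intro x y
    have h1 := h x y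
    have h2 := sub x ((1 / 2 : ℝ) • (x + y))
    have e : (1 / 2 : ℝ) • (x + y) - x = (1 / 2 : ℝ) • (y - x) := by module
    rw [e, map_smul, smul_eq_mul] at h2
    linarith
  have mono : ∀ x y : E, 2 * κ * ‖x - y‖ ≤ ‖J x - J y‖ := by
    intro x y
    have h1 := half x y
    have h2 := half y x
    rw [norm_sub_rev y x] at h2
    have h3 : (J x - J y) (x - y) = -J x (y - x) - J y (x - y) := by
      rw [sub_apply, ← neg_sub x y, map_neg]
      ring
    have h4 : (J x - J y) (x - y) ≤ ‖J x - J y‖ * ‖x - y‖ :=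
      (le_abs_self _).trans ((J x - J y).le_opNorm _)
    rcases (norm_nonneg (x - y)).eq_or_lt with h0 | h0
    · rw [← h0, mul_zero]
      exact norm_nonneg _
    · nlinarith
  set c := min 1 κ with hc
  have hc0 : 0 < c := by positivity
  have hc1 : c ≤ 1 := min_le_left _ _
  have hc2 : c ≤ κ := min_le_right _ _
  refine ⟨c, hc0, hc1, fun x y => ?_⟩
  rw [div_mul_eq_mul_div, le_div_iff₀ (by positivity)]
  have h1 := mono x y
  have h2 : c ^ 2 ≤ κ := by nlinarith
  nlinarith [mul_le_mul_of_nonneg_left h2 (norm_nonneg (x - y)), norm_nonneg (x - y),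
    norm_nonneg (J x - J y)]

theorem TwoUniformlyConvex.bestC_isGreatest (h : TwoUniformlyConvex E) :
    IsGreatest (convexityConstants E) (bestC E) := by
  have hne := h.convexityConstants_nonempty
  have hbdd : BddAbove (convexityConstants E) := ⟨1, fun c hc => hc.2.1⟩
  have hpos : 0 < bestC E := by
    obtain ⟨c, hc⟩ := hne
    exact hc.1.trans_le (le_csSup hbdd hc)
  refine ⟨⟨hpos, csSup_le hne fun c hc => hc.2.1, fun x y => ?_⟩, fun c hc => le_csSup hbdd hc⟩
  rw [div_mul_eq_mul_div, le_div_iff₀ (by positivity)]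
  by_contra! hlt
  have hcl : IsClosed {c : ℝ | ‖x - y‖ * c ^ 2 ≤ 2 * ‖J x - J y‖} :=
    isClosed_le (by fun_prop) (by fun_prop)
  have hmem : bestC E ∈ closure (convexityConstants E) := csSup_mem_closure hne hbdd
  have hsub : convexityConstants E ⊆ {c : ℝ | ‖x - y‖ * c ^ 2 ≤ 2 * ‖J x - J y‖} := by
    intro c hc
    have h1 := hc.2.2 x y
    rwa [div_mul_eq_mul_div, le_div_iff₀ (by have := hc.1; positivity)] at h1
  exact absurd (closure_minimal hsub hcl hmem) (not_le.mpr hlt)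

end WellDefined

section Problems

variable {E : Type*} [NormedAddCommGroup E] [NormedSpace ℝ E]

/-! Maps with domain `C` are represented by functions on `E`; only their values on `C` enter the
definitions below. -/

/-- The solution set `VI(A, C)` of the variational inequality. -/
def VI (C : Set E) (A : E → (E →L[ℝ] ℝ)) : Set E :=
  {p | p ∈ C ∧ ∀ q ∈ C, 0 ≤ A p (q - p)}

/-- Conditions (V1), (V2), (V3) for `A : C → E*`, with constant `α` of inverse strong
monotonicity. -/
structure ConditionsV (C : Set E) (α : ℝ) (A : E → (E →L[ℝ] ℝ)) : Prop where
  inverseStronglyMonotone : ∀ x ∈ C, ∀ y ∈ C, α * ‖A x - A y‖ ^ 2 ≤ (A x - A y) (x - y)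
  nonempty : (VI C A).Nonempty
  norm_le : ∀ y ∈ C, ∀ u ∈ VI C A, ‖A y‖ ≤ ‖A y - A u‖

/-- The solution set `EP(f)` of the equilibrium problem. -/
def EP (C : Set E) (f : E → E → ℝ) : Set E :=
  {p | p ∈ C ∧ ∀ y ∈ C, 0 ≤ f p y}

/-- Conditions (A1), (A2), (A3), (A4) for `f : C × C → ℝ`. -/
structure ConditionsA (C : Set E) (f : E → E → ℝ) : Prop where
  diag : ∀ x ∈ C, f x x = 0
  monotone : ∀ x ∈ C, ∀ y ∈ C, f x y + f y x ≤ 0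
  hemicontinuous : ∀ x ∈ C, ∀ y ∈ C, ∀ z ∈ C,
    limsup (fun t : ℝ => ((f (t • z + (1 - t) • x) y : ℝ) : EReal)) (𝓝[>] (0 : ℝ))
      ≤ ((f x y : ℝ) : EReal)
  convex : ∀ x ∈ C, ConvexOn ℝ C (f x)
  lowerSemicontinuous : ∀ x ∈ C, LowerSemicontinuousOn (f x) C

/-- `z` is a value `T_r x` of the resolvent of `f`: a solution of the regularized equilibrium
problem. -/
def IsResolvent (C : Set E) (f : E → E → ℝ) (r : ℝ) (x z : E) : Prop :=
  z ∈ C ∧ ∀ y ∈ C, 0 ≤ f z y + 1 / r * (J z - J x) (y - z)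

/-- The fixed point set of `S : C → C`. -/
def Fix (C : Set E) (S : E → E) : Set E := {x | x ∈ C ∧ S x = x}

/-- `S : C → C` is quasi-`φ`-asymptotically nonexpansive with sequence `k`. -/
structure QuasiPhiAsympNonexpansive (C : Set E) (k : ℕ → ℝ) (S : E → E) : Prop where
  fix_nonempty : (Fix C S).Nonempty
  one_le : ∀ n, 1 ≤ k n
  tendsto_one : Tendsto k atTop (𝓝 1)
  phi_le : ∀ n, 1 ≤ n → ∀ p ∈ Fix C S, ∀ x ∈ C, phi p (S^[n] x) ≤ k n * phi p x

/-- `S : C → C` is uniformly `L`-Lipschitz continuous. -/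
def UniformlyLipschitz (C : Set E) (L : ℝ) (S : E → E) : Prop :=
  ∀ n, 1 ≤ n → ∀ x ∈ C, ∀ y ∈ C, ‖S^[n] x - S^[n] y‖ ≤ L * ‖x - y‖

/-- The set `F` of common solutions. -/
def commonSolutions {M N K : ℕ} (C : Set E) (A : Fin M → E → (E →L[ℝ] ℝ))
    (S : Fin N → E → E) (f : Fin K → E → E → ℝ) : Set E :=
  (⋂ i, VI C (A i)) ∩ (⋂ j, Fix C (S j)) ∩ (⋂ k, EP C (f k))

/-- A run of the parallel hybrid iteration (Method A) started at `x₀`: all the sequences it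
produces, where the indices `iBar n`, `jBar n`, `kBar n` are any choice of maximizers. The
tolerance is `ε_n = (k_n - 1) (ω + ‖x_n‖) ^ 2`. -/
structure MethodA {M N K : ℕ} (C : Set E) (A : Fin M → E → (E →L[ℝ] ℝ)) (S : Fin N → E → E)
    (f : Fin K → E → E → ℝ) (k : ℕ → ℝ) (ω : ℝ) (al lam r : ℕ → ℝ) (x₀ : E) where
  x : ℕ → E
  y : ℕ → Fin M → E
  iBar : ℕ → Fin M
  z : ℕ → Fin N → E
  jBar : ℕ → Fin N
  u : ℕ → Fin K → E
  kBar : ℕ → Fin K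
  /-- the sets `C_n` -/
  D : ℕ → Set E
  x_zero : x 0 = x₀
  D_zero : D 0 = C
  /-- `y_n^i = Π_C (J⁻¹ (J x_n - λ_n A_i x_n))` -/
  y_spec : ∀ n i, ∃ w : E, J w = J (x n) - lam n • A i (x n) ∧ IsGenProj C w (y n i)
  iBar_spec : ∀ n i, ‖y n i - x n‖ ≤ ‖y n (iBar n) - x n‖
  /-- `z_n^j = J⁻¹ (α_n J x_n + (1 - α_n) J (S_j^n ȳ_n))` -/
  z_spec : ∀ n j, J (z n j) = al n • J (x n) + (1 - al n) • J ((S j)^[n] (y n (iBar n)))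
  jBar_spec : ∀ n j, ‖z n j - x n‖ ≤ ‖z n (jBar n) - x n‖
  /-- `u_n^k = T_{r_n}^k z̄_n` -/
  u_spec : ∀ n l, IsResolvent C (f l) (r n) (z n (jBar n)) (u n l)
  kBar_spec : ∀ n l, ‖u n l - x n‖ ≤ ‖u n (kBar n) - x n‖
  D_succ : ∀ n, D (n + 1) = {v | v ∈ D n ∧ phi v (u n (kBar n)) ≤ phi v (z n (jBar n)) ∧
    phi v (z n (jBar n)) ≤ phi v (x n) + (k n - 1) * (ω + ‖x n‖) ^ 2}
  /-- `x_{n+1} = Π_{C_{n+1}} x₀` -/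
  x_succ : ∀ n, IsGenProj (D (n + 1)) x₀ (x (n + 1))

end Problems

end HybridMethod

end

/-!
The iterates are generalized projections `x_n = Π_{C_n} x₀` onto a decreasing sequence of closed
convex sets, each of which contains the set `F` of common solutions. The projection inequality
`φ(x_m, x_n) ≤ φ(x_m, x₀) - φ(x_n, x₀)` for `n ≤ m`, together with the strong convexity
`κ ‖x - y‖ ^ 2 ≤ φ(x, y)` (`TwoUniformlyConvex.phi_bound`), makes `(x_n)` a Cauchy sequence
(`MethodA.cauchySeq`). Its limit `p` satisfies `φ(p, x₀) ≤ φ(q, x₀)` for all `q ∈ F`, and it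
remains to see that `p ∈ F`. As `x_{n+1} ∈ C_{n+1}`, the selected points `z̄_n`, `ū_n`, and by
maximality of the selected indices all `z_n^j`, `u_n^l`, converge to `p`. The Lyapunov estimate
`IsStep.phi_z_le` then gives `A_{i_n} x_n → 0`, hence `y_n^i → p`, and passing to the limit in the
relations defining `y_n^i`, `z_n^j`, `u_n^l` solves the three kinds of problems
(`MethodA.limit_mem_VI`, `MethodA.limit_mem_Fix`, `MethodA.limit_mem_EP`).

No reflexivity or weak compactness theorem is needed. Uniform smoothness makes `J` single-valued
and norm continuous (`UniformlySmooth.continuous_J`). Strong convexity makes the minimizing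
sequences of `y ↦ ‖y‖ ^ 2 - 2 ξ y` on a closed convex set Cauchy
(`TwoUniformlyConvex.exists_minimizer`); this yields the generalized projections and the
surjectivity of `J`. It also yields a finite intersection property for closed convex sets
(`TwoUniformlyConvex.nonempty_iInter`), on which the existence of the resolvents rests
(`ConditionsA.exists_isResolvent`): the dual (Minty) form of the regularized equilibrium problem
asks for a common point of closed convex sets, and for finitely many of them such a point comes
from the minimax theorem for a matrix game with nonpositive symmetric part.
-/

open Filter Topology

namespace HybridMethod

/-! ### The duality mapping and generalized projections -/

section Geometry

variable {E : Type*} [NormedAddCommGroup E] [NormedSpace ℝ E]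

theorem J_apply_self (x : E) : J x x = ‖x‖ ^ 2 := (J_mem x).1

theorem norm_J (x : E) : ‖J x‖ = ‖x‖ := (J_mem x).2

theorem phi_self (x : E) : phi x x = 0 := by
  rw [phi, J_apply_self]; ring

theorem J_apply_le (x y : E) : J x y ≤ ‖x‖ * ‖y‖ := by
  have := (le_abs_self _).trans ((J x).le_opNorm y)
  rwa [norm_J] at this

theorem sq_norm_sub_norm_le_phi (x y : E) : (‖x‖ - ‖y‖) ^ 2 ≤ phi x y := by
  have := J_apply_le y x
  rw [phi]; nlinarith

theorem phi_nonneg (x y : E) : 0 ≤ phi x y :=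
  (sq_nonneg _).trans (sq_norm_sub_norm_le_phi x y)

theorem phi_le_sq_norm_add_norm (x y : E) : phi x y ≤ (‖x‖ + ‖y‖) ^ 2 := by
  have := J_apply_le y (-x)
  rw [map_neg, norm_neg] at this
  rw [phi]; nlinarith

theorem phi_three_point (p z x : E) :
    phi p x = phi p z + phi z x + 2 * (J z - J x) (p - z) := by
  simp only [phi, sub_apply, map_sub, J_apply_self]
  ring

/-- `2 J x` is a subgradient of `‖·‖ ^ 2` at `x`. -/
theorem sq_norm_add_two_mul_J_le (x y : E) : ‖x‖ ^ 2 + 2 * J x (y - x) ≤ ‖y‖ ^ 2 := by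
  have := phi_nonneg y x
  rw [phi] at this
  rw [map_sub, J_apply_self]
  linarith

/-- The square of the norm is strongly convex: the Lyapunov functional dominates the square of
the distance. -/
theorem TwoUniformlyConvex.phi_bound (h : TwoUniformlyConvex E) :
    ∃ κ : ℝ, 0 < κ ∧ ∀ x y : E, κ * ‖x - y‖ ^ 2 ≤ phi x y := by
  obtain ⟨κ, hκ, h⟩ := h.midpoint_bound
  refine ⟨2 * κ, by positivity, fun y x => ?_⟩
  have h1 := h x y
  have h2 := sq_norm_add_two_mul_J_le x ((1 / 2 : ℝ) • (x + y))
  have e : (1 / 2 : ℝ) • (x + y) - x = (1 / 2 : ℝ) • (y - x) := by module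
  rw [e, map_smul, smul_eq_mul, map_sub, J_apply_self] at h2
  rw [phi, norm_sub_rev]
  linarith

/-- If `φ(xₙ, yₙ) → 0` then `xₙ - yₙ → 0`. -/
theorem TwoUniformlyConvex.tendsto_sub_of_phi (h : TwoUniformlyConvex E) {x y : ℕ → E}
    (hxy : Tendsto (fun n => phi (x n) (y n)) atTop (𝓝 0)) :
    Tendsto (fun n => x n - y n) atTop (𝓝 0) := by
  obtain ⟨κ, hκ, h⟩ := h.phi_bound
  have h1 : Tendsto (fun n => √(phi (x n) (y n) / κ)) atTop (𝓝 0) := by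
    have := (hxy.div_const κ).sqrt
    simpa using this
  refine squeeze_zero_norm (fun n => ?_) h1
  apply Real.le_sqrt_of_sq_le
  rw [le_div_iff₀ hκ, mul_comm]
  exact h _ _

/-- In a uniformly smooth space the functionals `J x`, for `x` in the unit sphere, are uniformly
approximated by the difference quotients of the norm at one common `t > 0`. The difference
quotient at `t > 0` dominates every element of the duality set, the one at `-t` is dominated by
it. -/
theorem UniformlySmooth.exists_quotient (h : UniformlySmooth E) {ε : ℝ} (hε : 0 < ε) :
    ∃ t : ℝ, 0 < t ∧ ∀ x y : E, ‖x‖ = 1 → ‖y‖ = 1 → ∀ ξ ∈ dualitySet x,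
      |(‖x + t • y‖ - ‖x‖) / t - ξ y| ≤ ε := by
  obtain ⟨G, hG⟩ := h
  rw [Metric.tendstoUniformlyOn_iff] at hG
  have h1 := hG (ε / 2) (by positivity)
  rw [eventually_nhdsWithin_iff, Metric.eventually_nhds_iff] at h1
  obtain ⟨δ, hδ, h1⟩ := h1
  refine ⟨δ / 2, by positivity, fun x y hx hy ξ hξ => ?_⟩
  have hxy : (x, y) ∈ Metric.sphere (0 : E) 1 ×ˢ Metric.sphere (0 : E) 1 := by simp [hx, hy]
  have hp := h1 (y := δ / 2) (by rw [Real.dist_eq, sub_zero, abs_of_pos] <;> linarith)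
    (by simp; positivity) (x, y) hxy
  have hm := h1 (y := -(δ / 2)) (by rw [Real.dist_eq, sub_zero, abs_neg, abs_of_pos] <;> linarith)
    (by simp; positivity) (x, y) hxy
  rw [Real.dist_eq, abs_lt] at hp hm
  simp only at hp hm
  set t := δ / 2 with ht
  have ht0 : 0 < t := by positivity
  have key : ∀ s : ℝ, s * ξ y ≤ ‖x + s • y‖ - ‖x‖ := by
    intro s
    have h2 : ξ (x + s • y) ≤ ‖x + s • y‖ := by
      have := (le_abs_self _).trans (ξ.le_opNorm (x + s • y))
      rwa [hξ.2, hx, one_mul] at this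
    rw [map_add, map_smul, hξ.1, smul_eq_mul, hx] at h2
    rw [hx]; linarith
  have k1 : ξ y ≤ (‖x + t • y‖ - ‖x‖) / t := by
    rw [le_div_iff₀ ht0]; linarith [key t]
  have k2 : (‖x + (-t) • y‖ - ‖x‖) / (-t) ≤ ξ y := by
    rw [div_neg, neg_le, le_div_iff₀ ht0]; linarith [key (-t)]
  rw [abs_le]
  constructor <;> linarith

theorem dualitySet_smul {x : E} {ξ : E →L[ℝ] ℝ} (hξ : ξ ∈ dualitySet x) {s : ℝ} (hs : 0 ≤ s) :
    s • ξ ∈ dualitySet (s • x) := by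
  refine ⟨?_, ?_⟩
  · rw [norm_smul, Real.norm_of_nonneg hs]
    simp [hξ.1]; ring
  · rw [norm_smul, norm_smul, hξ.2]

theorem UniformlySmooth.dist_le_of_unit (h : UniformlySmooth E) {ε : ℝ} (hε : 0 < ε) :
    ∃ δ : ℝ, 0 < δ ∧ ∀ x x' : E, ‖x‖ = 1 → ‖x'‖ = 1 → ‖x - x'‖ ≤ δ →
      ∀ ξ ∈ dualitySet x, ∀ η ∈ dualitySet x', ‖ξ - η‖ ≤ ε := by
  obtain ⟨t, ht, h⟩ := h.exists_quotient (ε := ε / 4) (by positivity)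
  refine ⟨t * ε / 4, by positivity, fun x x' hx hx' hd ξ hξ η hη => ?_⟩
  refine ContinuousLinearMap.opNorm_le_of_unit_norm hε.le fun y hy => ?_
  have h1 := abs_le.1 (h x y hx hy ξ hξ)
  have h2 := abs_le.1 (h x' y hx' hy η hη)
  have h3 : |‖x + t • y‖ - ‖x' + t • y‖| ≤ t * ε / 4 := by
    refine (abs_norm_sub_norm_le _ _).trans ?_
    rwa [add_sub_add_right_eq_sub]
  have h4 : |(‖x + t • y‖ - ‖x‖) / t - (‖x' + t • y‖ - ‖x'‖) / t| ≤ ε / 4 := by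
    rw [hx, hx', ← sub_div, sub_sub_sub_cancel_right, abs_div, abs_of_pos ht,
      div_le_iff₀ ht]
    linarith
  have h5 := abs_le.1 h4
  rw [Real.norm_eq_abs, sub_apply, abs_le]
  constructor <;> linarith

/-- A uniformly smooth space is smooth: the duality set of `x` is `{J x}`. -/
theorem UniformlySmooth.eq_J (h : UniformlySmooth E) {x : E} {ξ : E →L[ℝ] ℝ}
    (hξ : ξ ∈ dualitySet x) : ξ = J x := by
  rcases eq_or_ne x 0 with rfl | hx
  · rw [norm_eq_zero.1 (hξ.2.trans norm_zero), norm_eq_zero.1 ((norm_J 0).trans norm_zero)]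
  have hx0 : 0 < ‖x‖ := norm_pos_iff.2 hx
  have h1 : ‖‖x‖⁻¹ • x‖ = 1 := norm_smul_inv_norm hx
  have h2 : ‖‖x‖⁻¹ • ξ - ‖x‖⁻¹ • J x‖ ≤ 0 := by
    refine le_of_forall_pos_le_add fun ε hε => ?_
    obtain ⟨δ, hδ, h⟩ := h.dist_le_of_unit hε
    rw [zero_add]
    exact h _ _ h1 h1 (by simpa using hδ.le) _ (dualitySet_smul hξ (by positivity))
      _ (dualitySet_smul (J_mem x) (by positivity))
  have h3 := sub_eq_zero.1 (norm_le_zero_iff.1 h2)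
  exact smul_right_injective _ (inv_ne_zero hx0.ne') h3

theorem UniformlySmooth.J_smul (h : UniformlySmooth E) (x : E) {s : ℝ} (hs : 0 ≤ s) :
    J (s • x) = s • J x :=
  (h.eq_J (dualitySet_smul (J_mem x) hs)).symm

/-- The duality mapping of a uniformly smooth space is norm-to-norm continuous. -/
theorem UniformlySmooth.continuous_J (h : UniformlySmooth E) :
    Continuous (J : E → E →L[ℝ] ℝ) := by
  rw [continuous_iff_continuousAt]
  intro x
  rcases eq_or_ne x 0 with rfl | hx
  · have h0 : J (0 : E) = 0 := norm_eq_zero.1 ((norm_J 0).trans norm_zero)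
    rw [ContinuousAt, h0, tendsto_zero_iff_norm_tendsto_zero]
    simp only [norm_J]
    exact tendsto_norm_zero
  have hc : ContinuousAt (fun y : E => ‖y‖⁻¹ • y) x :=
    (continuousAt_id.norm.inv₀ (norm_ne_zero_iff.2 hx)).smul continuousAt_id
  have hJ : ContinuousAt (fun y : E => J (‖y‖⁻¹ • y)) x := by
    rw [Metric.continuousAt_iff']
    intro ε hε
    obtain ⟨δ, hδ, hu⟩ := h.dist_le_of_unit (half_pos hε)
    filter_upwards [Metric.continuousAt_iff'.1 hc δ hδ, isOpen_ne.mem_nhds hx] with y hy hy0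
    rw [dist_eq_norm] at hy ⊢
    refine lt_of_le_of_lt ?_ (half_lt_self hε)
    exact hu _ _ (norm_smul_inv_norm hy0) (norm_smul_inv_norm hx) hy.le _ (J_mem _) _ (J_mem _)
  have hm : ContinuousAt (fun y : E => ‖y‖ • J (‖y‖⁻¹ • y)) x := continuousAt_id.norm.smul hJ
  refine hm.congr ?_
  filter_upwards [isOpen_ne.mem_nhds hx] with y hy
  rw [h.J_smul _ (by positivity), smul_smul, mul_inv_cancel₀ (norm_ne_zero_iff.2 hy), one_smul]

/-- Strong midpoint convexity of `y ↦ ‖y‖ ^ 2 - 2 ξ y`. -/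
theorem TwoUniformlyConvex.midpoint_sub_bound (h : TwoUniformlyConvex E) :
    ∃ κ : ℝ, 0 < κ ∧ ∀ (ξ : E →L[ℝ] ℝ) (m : ℝ) (D : Set E), Convex ℝ D →
      (∀ y ∈ D, m ≤ ‖y‖ ^ 2 - 2 * ξ y) → ∀ x ∈ D, ∀ y ∈ D,
      κ * ‖x - y‖ ^ 2 ≤ (‖x‖ ^ 2 - 2 * ξ x - m) + (‖y‖ ^ 2 - 2 * ξ y - m) := by
  obtain ⟨κ, hκ, h⟩ := h.midpoint_bound
  refine ⟨2 * κ, by positivity, fun ξ m D hD hm x hx y hy => ?_⟩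
  have h1 := h x y
  have h2 := hm ((1 / 2 : ℝ) • (x + y)) (by
    rw [smul_add]
    exact hD hx hy (by norm_num) (by norm_num) (by norm_num))
  rw [map_smul, map_add, smul_eq_mul] at h2
  linarith

/-- The functional `y ↦ ‖y‖ ^ 2 - 2 ξ y` has a minimizer on every nonempty closed convex set,
since by strong convexity its minimizing sequences are Cauchy. -/
theorem TwoUniformlyConvex.exists_minimizer [CompleteSpace E] (h : TwoUniformlyConvex E)
    {D : Set E} (hne : D.Nonempty) (hcl : IsClosed D) (hco : Convex ℝ D) (ξ : E →L[ℝ] ℝ) :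
    ∃ p ∈ D, ∀ y ∈ D, ‖p‖ ^ 2 - 2 * ξ p ≤ ‖y‖ ^ 2 - 2 * ξ y := by
  obtain ⟨κ, hκ, h⟩ := h.midpoint_sub_bound
  set g : E → ℝ := fun y => ‖y‖ ^ 2 - 2 * ξ y with hg
  have hgc : Continuous g := by fun_prop
  have hbdd : BddBelow (g '' D) := by
    refine ⟨-‖ξ‖ ^ 2, ?_⟩
    rintro _ ⟨y, -, rfl⟩
    have := (le_abs_self _).trans (ξ.le_opNorm y)
    simp only [hg]
    nlinarith [sq_nonneg (‖ξ‖ - ‖y‖)]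
  set m := sInf (g '' D) with hm
  have hmle : ∀ y ∈ D, m ≤ g y := fun y hy => csInf_le hbdd ⟨y, hy, rfl⟩
  obtain ⟨v, -, hv, hvm⟩ := exists_seq_tendsto_sInf (hne.image g) hbdd
  choose y hyD hy using hvm
  have hy' : Tendsto (fun n => g (y n)) atTop (𝓝 m) := by simpa only [hy] using hv
  have hcau : CauchySeq y := by
    rw [Metric.cauchySeq_iff']
    intro ε hε
    have h1 : ∀ᶠ n in atTop, g (y n) < m + κ * ε ^ 2 / 2 :=
      hy'.eventually_lt_const (by have : 0 < κ * ε ^ 2 := by positivity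
                                  linarith)
    obtain ⟨N, hN⟩ := eventually_atTop.1 h1
    refine ⟨N, fun n hn => ?_⟩
    have h2 := h ξ m D hco hmle (y n) (hyD n) (y N) (hyD N)
    have h3 := hN n hn
    have h4 := hN N le_rfl
    simp only [hg] at h3 h4
    rw [dist_eq_norm]
    refine lt_of_pow_lt_pow_left₀ 2 hε.le ?_
    refine lt_of_mul_lt_mul_left ?_ hκ.le
    linarith
  obtain ⟨p, hp⟩ := cauchySeq_tendsto_of_complete hcau
  refine ⟨p, hcl.mem_of_tendsto hp (Eventually.of_forall hyD), fun z hz => ?_⟩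
  have := tendsto_nhds_unique ((hgc.tendsto p).comp hp) hy'
  exact this.le.trans (hmle z hz)

/-- The variational inequality satisfied by a minimizer of `y ↦ ‖y‖ ^ 2 - 2 ξ y`. -/
theorem UniformlySmooth.variational (h : UniformlySmooth E) {D : Set E} (hco : Convex ℝ D)
    {ξ : E →L[ℝ] ℝ} {p : E} (hpD : p ∈ D) (hp : ∀ y ∈ D, ‖p‖ ^ 2 - 2 * ξ p ≤ ‖y‖ ^ 2 - 2 * ξ y)
    {q : E} (hq : q ∈ D) : 0 ≤ (J p - ξ) (q - p) := by
  have hc : Tendsto (fun t : ℝ => (J (p + t • (q - p)) - ξ) (q - p)) (𝓝[>] 0)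
      (𝓝 ((J p - ξ) (q - p))) := by
    have : Continuous fun t : ℝ => (J (p + t • (q - p)) - ξ) (q - p) := by
      have := h.continuous_J
      fun_prop
    have h1 := (this.tendsto 0).mono_left (nhdsWithin_le_nhds (s := Set.Ioi 0))
    simpa using h1
  refine ge_of_tendsto hc ?_
  filter_upwards [Ioo_mem_nhdsGT (zero_lt_one' ℝ)] with t ht
  have h1 := hp _ (hco.add_smul_sub_mem hpD hq ⟨ht.1.le, ht.2.le⟩)
  have h2 := sq_norm_add_two_mul_J_le (p + t • (q - p)) p
  have e : p - (p + t • (q - p)) = -(t • (q - p)) := by abel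
  rw [e, map_neg, map_smul, smul_eq_mul] at h2
  rw [map_add, map_smul, smul_eq_mul] at h1
  have h3 : 0 ≤ t * (J (p + t • (q - p)) - ξ) (q - p) := by
    rw [sub_apply, mul_sub]; linarith
  exact nonneg_of_mul_nonneg_right h3 ht.1

/-- The duality mapping of a uniformly smooth, `2`-uniformly convex Banach space is onto: the
preimage of `ξ` is the global minimizer of `y ↦ ‖y‖ ^ 2 - 2 ξ y`. -/
theorem J_surjective [CompleteSpace E] (hs : UniformlySmooth E) (hc : TwoUniformlyConvex E) :
    Function.Surjective (J : E → E →L[ℝ] ℝ) := by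
  intro ξ
  obtain ⟨p, hpD, hp⟩ := hc.exists_minimizer Set.univ_nonempty isClosed_univ convex_univ ξ
  refine ⟨p, ?_⟩
  rw [← sub_eq_zero]
  ext v
  have h1 := hs.variational convex_univ hpD hp (Set.mem_univ (p + v))
  have h2 := hs.variational convex_univ hpD hp (Set.mem_univ (p - v))
  rw [add_sub_cancel_left] at h1
  rw [sub_sub_cancel_left, map_neg] at h2
  rw [zero_apply]
  linarith

theorem TwoUniformlyConvex.exists_isGenProj [CompleteSpace E] (h : TwoUniformlyConvex E)
    {D : Set E} (hne : D.Nonempty) (hcl : IsClosed D) (hco : Convex ℝ D) (x : E) :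
    ∃ p, IsGenProj D x p := by
  obtain ⟨p, hpD, hp⟩ := h.exists_minimizer hne hcl hco (J x)
  refine ⟨p, hpD, fun y hy => ?_⟩
  have := hp y hy
  rw [phi, phi]; linarith

/-- The variational inequality characterizing the generalized projection. -/
theorem IsGenProj.variational (h : UniformlySmooth E) {D : Set E} (hco : Convex ℝ D) {x p : E}
    (hp : IsGenProj D x p) {q : E} (hq : q ∈ D) : 0 ≤ (J p - J x) (q - p) := by
  refine h.variational hco hp.1 (fun y hy => ?_) hq
  have := hp.2 y hy
  rw [phi, phi] at this; linarith

theorem IsGenProj.phi_add_le (h : UniformlySmooth E) {D : Set E} (hco : Convex ℝ D) {x p : E}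
    (hp : IsGenProj D x p) {q : E} (hq : q ∈ D) : phi q p + phi p x ≤ phi q x := by
  have := hp.variational h hco hq
  rw [phi_three_point q p x]; linarith

theorem IsGenProj.unique (hs : UniformlySmooth E) (hc : TwoUniformlyConvex E) {D : Set E}
    (hco : Convex ℝ D) {x p q : E} (hp : IsGenProj D x p) (hq : IsGenProj D x q) : p = q := by
  obtain ⟨κ, hκ, h⟩ := hc.phi_bound
  have h1 := hp.phi_add_le hs hco hq.1
  have h2 := hq.2 p hp.1
  have h3 := h q p
  have h4 : ‖q - p‖ ^ 2 ≤ 0 := by nlinarith [sq_nonneg ‖q - p‖]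
  have h5 : ‖q - p‖ = 0 := by nlinarith [norm_nonneg (q - p)]
  exact (sub_eq_zero.1 (norm_eq_zero.1 h5)).symm

end Geometry

/-! ### Equilibrium problems and resolvents -/

section Equilibrium

variable {E : Type*} [NormedAddCommGroup E] [NormedSpace ℝ E]

/-- A family of closed convex sets, one of them bounded, has a common point as soon as every
finite subfamily has. The points of minimal norm of the finite intersections form a Cauchy net,
which takes the place of weak compactness. -/
theorem TwoUniformlyConvex.nonempty_iInter [CompleteSpace E] (h : TwoUniformlyConvex E)
    {ι : Type*} {G : ι → Set E} (hcl : ∀ i, IsClosed (G i)) (hco : ∀ i, Convex ℝ (G i))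
    (hfin : ∀ s : Finset ι, (⋂ i ∈ s, G i).Nonempty) {i₀ : ι} {B : ℝ}
    (hB : ∀ x ∈ G i₀, ‖x‖ ≤ B) : (⋂ i, G i).Nonempty := by
  classical
  have hI : ∀ s : Finset ι, Convex ℝ (⋂ i ∈ s, G i) := fun s =>
    convex_iInter₂ fun i _ => hco i
  have hex : ∀ s : Finset ι, ∃ p ∈ ⋂ i ∈ s, G i, ∀ y ∈ ⋂ i ∈ s, G i, ‖p‖ ^ 2 ≤ ‖y‖ ^ 2 := by
    intro s
    obtain ⟨p, hp, hmin⟩ := h.exists_minimizer (hfin s)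
      (isClosed_biInter fun i _ => hcl i) (hI s) 0
    exact ⟨p, hp, by simpa using hmin⟩
  choose p hp hmin using hex
  obtain ⟨κ, hκ, h⟩ := h.midpoint_sub_bound
  have hmem : ∀ s i, i ∈ s → p s ∈ G i := fun s i hi => Set.mem_iInter₂.1 (hp s) i hi
  have hsub : ∀ s t, s ⊆ t → p t ∈ ⋂ i ∈ s, G i := fun s t hst =>
    Set.mem_iInter₂.2 fun i hi => hmem t i (hst hi)
  set V : Set ℝ := Set.range fun s : Finset ι => ‖p (insert i₀ s)‖ ^ 2 with hV
  have hVb : BddAbove V := by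
    refine ⟨B ^ 2, ?_⟩
    rintro _ ⟨s, rfl⟩
    exact pow_le_pow_left₀ (norm_nonneg _) (hB _ (hmem _ _ (Finset.mem_insert_self _ _))) 2
  -- The norms of the `p s` increase with `s` and are bounded once `i₀ ∈ s`.
  have hcau : CauchySeq p := by
    rw [Metric.cauchySeq_iff']
    intro ε hε
    obtain ⟨_, ⟨s, rfl⟩, hs⟩ := exists_lt_of_lt_csSup (s := V) (b := sSup V - κ * ε ^ 2)
      (Set.range_nonempty _) (by have : 0 < κ * ε ^ 2 := by positivity
                                 linarith)
    refine ⟨insert i₀ s, fun t ht => ?_⟩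
    have ht' : insert i₀ t = t :=
      Finset.insert_eq_of_mem (ht (Finset.mem_insert_self _ _))
    have h1 : ‖p t‖ ^ 2 ≤ sSup V := le_csSup hVb ⟨t, by simp only [ht']⟩
    have h2 := h 0 (‖p (insert i₀ s)‖ ^ 2) _ (hI (insert i₀ s))
      (by simpa using hmin (insert i₀ s)) (p t) (hsub _ _ ht) _ (hp (insert i₀ s))
    simp only [zero_apply, mul_zero, sub_zero, sub_self, add_zero] at h2
    rw [dist_eq_norm]
    refine lt_of_pow_lt_pow_left₀ 2 hε.le (lt_of_mul_lt_mul_left ?_ hκ.le)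
    linarith
  obtain ⟨q, hq⟩ := cauchySeq_tendsto_of_complete hcau
  refine ⟨q, Set.mem_iInter.2 fun i => (hcl i).mem_of_tendsto hq ?_⟩
  filter_upwards [eventually_ge_atTop ({i} : Finset ι)] with s hs
  exact hmem s i (hs (Finset.mem_singleton_self i))

/-- A matrix game whose payoff has nonpositive symmetric part can be kept at value at most `0`
by a mixed strategy: at a saddle point `(a, b)`, answer `b` by `b` itself. -/
theorem exists_mem_stdSimplex_sum_nonpos {ι : Type*} [Fintype ι] [Nonempty ι] (m : ι → ι → ℝ)
    (hm : ∀ i j, m i j + m j i ≤ 0) :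
    ∃ t ∈ stdSimplex ℝ ι, ∀ j, ∑ i, t i * m j i ≤ 0 := by
  classical
  set F : (ι → ℝ) → (ι → ℝ) → ℝ := fun x y => ∑ j, y j * ∑ i, x i * m j i with hF
  have hadd : ∀ (x x' y : ι → ℝ) (c c' : ℝ), F (c • x + c' • x') y = c * F x y + c' * F x' y := by
    intro x x' y c c'
    simp only [hF, Finset.mul_sum, ← Finset.sum_add_distrib, Pi.add_apply, Pi.smul_apply,
      smul_eq_mul]
    exact Finset.sum_congr rfl fun j _ => Finset.sum_congr rfl fun i _ => by ring
  have hadd' : ∀ (x y y' : ι → ℝ) (c c' : ℝ), F x (c • y + c' • y') = c * F x y + c' * F x y' := by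
    intro x y y' c c'
    simp only [hF, Finset.mul_sum, ← Finset.sum_add_distrib, Pi.add_apply, Pi.smul_apply,
      smul_eq_mul]
    exact Finset.sum_congr rfl fun j _ => Finset.sum_congr rfl fun i _ => by ring
  have hne : (stdSimplex ℝ ι).Nonempty := ⟨_, single_mem_stdSimplex ℝ (Classical.arbitrary ι)⟩
  have hcon : Convex ℝ (stdSimplex ℝ ι) := convex_stdSimplex ℝ ι
  obtain ⟨a, ha, b, hb, hab⟩ := Sion.exists_isSaddlePointOn (f := F) hne hcon
    (isCompact_stdSimplex ℝ ι)
    (fun y _ => (show Continuous fun x => F x y by fun_prop).continuousOn.lowerSemicontinuousOn)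
    (fun y _ => ConvexOn.quasiconvexOn ⟨hcon, fun x _ x' _ c c' _ _ _ => (hadd x x' y c c').le⟩)
    hcon hne (isCompact_stdSimplex ℝ ι)
    (fun x _ => (show Continuous fun y => F x y by fun_prop).continuousOn.upperSemicontinuousOn)
    (fun x _ => ConcaveOn.quasiconcaveOn ⟨hcon, fun y _ y' _ c c' _ _ _ => (hadd' x y y' c c').ge⟩)
  refine ⟨a, ha, fun j => ?_⟩
  -- The saddle point inequality, applied at `b` and at the `j`-th pure strategy.
  have h1 := hab b hb _ (single_mem_stdSimplex ℝ j)
  have h2 : F a (Pi.single j 1) = ∑ i, a i * m j i := by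
    simp [hF, Pi.single_apply]
  have h3 : F b b + F b b ≤ 0 := by
    have e : F b b = ∑ j, ∑ i, b j * b i * m j i := by
      simp only [hF, Finset.mul_sum, mul_assoc]
    have e' : F b b = ∑ j, ∑ i, b j * b i * m i j := by
      rw [e, Finset.sum_comm]
      exact Finset.sum_congr rfl fun j _ => Finset.sum_congr rfl fun i _ => by ring
    nth_rewrite 1 [e]
    rw [e']
    simp only [← Finset.sum_add_distrib]
    refine Finset.sum_nonpos fun j _ => Finset.sum_nonpos fun i _ => ?_
    rw [← mul_add]
    exact mul_nonpos_of_nonneg_of_nonpos (mul_nonneg (hb.1 j) (hb.1 i)) (hm j i)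
  linarith

/-- The sets `{z ∈ C | g y z ≤ 0}` of a monotone bifunction `g` have a common point, provided one
of them is bounded. -/
theorem TwoUniformlyConvex.exists_forall_nonpos [CompleteSpace E] (h : TwoUniformlyConvex E)
    {C : Set E} (hcl : IsClosed C) {g : E → E → ℝ}
    (hmono : ∀ x ∈ C, ∀ y ∈ C, g x y + g y x ≤ 0) (hconv : ∀ x ∈ C, ConvexOn ℝ C (g x))
    (hlsc : ∀ x ∈ C, LowerSemicontinuousOn (g x) C) {y₀ : E} (hy₀ : y₀ ∈ C) {B : ℝ}
    (hB : ∀ z ∈ C, g y₀ z ≤ 0 → ‖z‖ ≤ B) : ∃ z ∈ C, ∀ y ∈ C, g y z ≤ 0 := by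
  classical
  have hcl' : ∀ y : C, IsClosed {z | z ∈ C ∧ g y z ≤ 0} := by
    intro y
    obtain ⟨v, hv, hveq⟩ := lowerSemicontinuousOn_iff_preimage_Iic.1 (hlsc y y.2) 0
    have e : {z | z ∈ C ∧ g y z ≤ 0} = C ∩ v := by
      rw [← hveq]; rfl
    rw [e]
    exact hcl.inter hv
  have hco' : ∀ y : C, Convex ℝ {z | z ∈ C ∧ g y z ≤ 0} := fun y => (hconv y y.2).convex_le 0
  have hfin : ∀ s : Finset C, (⋂ y ∈ s, {z | z ∈ C ∧ g y z ≤ 0}).Nonempty := by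
    intro s
    rcases s.eq_empty_or_nonempty with rfl | hs
    · simp
    have : Nonempty s := hs.to_subtype
    obtain ⟨t, ht, hts⟩ := exists_mem_stdSimplex_sum_nonpos (ι := s)
      (fun i j => g (i : C) (j : C)) fun i j => hmono _ i.1.2 _ j.1.2
    have hmem : ∑ i, t i • ((i : C) : E) ∈ C :=
      (hconv y₀ hy₀).1.sum_mem (fun i _ => ht.1 i) ht.2 fun i _ => i.1.2
    refine ⟨∑ i, t i • ((i : C) : E), Set.mem_iInter₂.2 fun y hy => ⟨hmem, ?_⟩⟩
    refine ((hconv y y.2).map_sum_le (fun i _ => ht.1 i) ht.2 fun i _ => i.1.2).trans ?_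
    simpa using hts ⟨y, hy⟩
  obtain ⟨z, hz⟩ := h.nonempty_iInter hcl' hco' hfin (i₀ := ⟨y₀, hy₀⟩) (B := B)
    fun z hz => hB z hz.1 hz.2
  have hz' := fun y : C => Set.mem_iInter.1 hz y
  exact ⟨z, (hz' ⟨y₀, hy₀⟩).1, fun y hy => (hz' ⟨y, hy⟩).2⟩

/-- A convex function that is lower semicontinuous and vanishes at a point decreases at most
linearly away from that point. -/
theorem exists_neg_linear_le {C : Set E} {g : E → ℝ} (hconv : ConvexOn ℝ C g) {y : E} (hy : y ∈ C)
    (hlsc : LowerSemicontinuousOn g C) (hg : g y = 0) :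
    ∃ c : ℝ, 0 < c ∧ ∀ z ∈ C, -(c * ‖z - y‖) - 1 ≤ g z := by
  have h1 : ∀ᶠ z in 𝓝[C] y, -1 < g z := hlsc y hy (-1) (by simp [hg])
  rw [eventually_nhdsWithin_iff, Metric.eventually_nhds_iff] at h1
  obtain ⟨δ, hδ, h1⟩ := h1
  refine ⟨2 / δ, by positivity, fun z hz => ?_⟩
  rcases lt_or_ge ‖z - y‖ δ with hlt | hge
  · have := h1 (by rwa [dist_eq_norm]) hz
    have h2 : 0 ≤ 2 / δ * ‖z - y‖ := by positivity
    linarith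
  have hn : 0 < ‖z - y‖ := hδ.trans_le hge
  set s := δ / 2 / ‖z - y‖ with hs
  have hs0 : 0 < s := by positivity
  have hs1 : s ≤ 1 := by rw [hs, div_le_one hn]; linarith
  have hsn : s * ‖z - y‖ = δ / 2 := by rw [hs]; field_simp
  have h2 := hconv.2 hz hy hs0.le (sub_nonneg.2 hs1) (by ring : s + (1 - s) = 1)
  have hmem := hconv.1 hz hy hs0.le (sub_nonneg.2 hs1) (by ring : s + (1 - s) = 1)
  have h3 : -1 < g (s • z + (1 - s) • y) := by
    refine h1 ?_ hmem
    have e : s • z + (1 - s) • y - y = s • (z - y) := by module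
    rw [dist_eq_norm, e, norm_smul, Real.norm_of_nonneg hs0.le, hsn]
    linarith
  rw [hg, smul_zero, add_zero, smul_eq_mul] at h2
  have h4 : -1 < s * g z := h3.trans_le h2
  have h5 : -(2 / δ * ‖z - y‖) * s = -1 := by
    have : 2 / δ * (s * ‖z - y‖) = 1 := by rw [hsn]; field_simp
    linarith
  have h6 : -(2 / δ * ‖z - y‖) < g z := lt_of_mul_lt_mul_right (by linarith) hs0.le
  linarith

/-- Condition (A3), stated without `limsup`: a lower bound for `f(·, y)` along the segment from
`x` to `z` passes to the limit at `x`. -/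
theorem ConditionsA.le_of_tendsto {C : Set E} {f : E → E → ℝ} (hf : ConditionsA C f) {x y z : E}
    (hx : x ∈ C) (hy : y ∈ C) (hz : z ∈ C) {c : ℝ → ℝ} {c₀ : ℝ}
    (hc : Tendsto c (𝓝[>] 0) (𝓝 c₀))
    (hle : ∀ᶠ t : ℝ in 𝓝[>] 0, c t ≤ f (t • z + (1 - t) • x) y) : c₀ ≤ f x y := by
  have h1 : Tendsto (fun t => (c t : EReal)) (𝓝[>] 0) (𝓝 (c₀ : EReal)) :=
    (continuous_coe_real_ereal.tendsto c₀).comp hc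
  have h2 : limsup (fun t => (c t : EReal)) (𝓝[>] 0)
      ≤ limsup (fun t : ℝ => ((f (t • z + (1 - t) • x) y : ℝ) : EReal)) (𝓝[>] 0) :=
    limsup_le_limsup (hle.mono fun t ht => EReal.coe_le_coe_iff.2 ht)
  rw [h1.limsup_eq] at h2
  exact_mod_cast h2.trans (hf.hemicontinuous x hx y hy z hz)

/-- Minty's lemma for the bifunction `f(z, y) + ρ ⟨y - z, J z - J x⟩`: a solution of the dual
problem solves the primal one. For `ρ = 0` this concerns the equilibrium problem of `f`. -/
theorem ConditionsA.minty (hs : UniformlySmooth E) {C : Set E} (hco : Convex ℝ C)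
    {f : E → E → ℝ} (hf : ConditionsA C f) (ρ : ℝ) (x : E) {z : E} (hz : z ∈ C)
    (h : ∀ y ∈ C, f y z + ρ * (J y - J x) (z - y) ≤ 0) :
    ∀ y ∈ C, 0 ≤ f z y + ρ * (J z - J x) (y - z) := by
  intro y hy
  have hcont : Continuous fun t : ℝ => -(ρ * (J (t • y + (1 - t) • z) - J x)
      (y - (t • y + (1 - t) • z))) := by
    have := hs.continuous_J
    fun_prop
  have hlim : Tendsto (fun t : ℝ => -(ρ * (J (t • y + (1 - t) • z) - J x)
      (y - (t • y + (1 - t) • z)))) (𝓝[>] 0) (𝓝 (-(ρ * (J z - J x) (y - z)))) := by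
    have h1 := (hcont.tendsto 0).mono_left (nhdsWithin_le_nhds (s := Set.Ioi 0))
    simpa using h1
  have := hf.le_of_tendsto hz hy hy hlim ?_
  · linarith
  filter_upwards [Ioo_mem_nhdsGT (zero_lt_one' ℝ)] with t ht
  have ht1 : 0 < 1 - t := by linarith [ht.2]
  set w := t • y + (1 - t) • z with hw
  have hwC : w ∈ C := hco hy hz ht.1.le ht1.le (by ring)
  have h1 := h w hwC
  have h2 := (hf.convex w hwC).2 hy hz ht.1.le ht1.le (by ring)
  rw [← hw, hf.diag w hwC, smul_eq_mul, smul_eq_mul] at h2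
  -- The two linear terms at `w` cancel in the convex combination.
  have e : t • (y - w) + (1 - t) • (z - w) = 0 := by rw [hw]; module
  have h4 := congrArg (J w - J x) e
  rw [map_add, map_smul, map_smul, map_zero, smul_eq_mul, smul_eq_mul] at h4
  have h5 : 0 ≤ t * (f w y + ρ * (J w - J x) (y - w)) := by
    have h6 := mul_le_mul_of_nonneg_left h1 ht1.le
    linear_combination h2 + h6 - ρ * h4
  have := nonneg_of_mul_nonneg_right h5 ht.1
  linarith

theorem ConditionsA.mem_EP_iff (hs : UniformlySmooth E) {C : Set E} (hco : Convex ℝ C)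
    {f : E → E → ℝ} (hf : ConditionsA C f) {z : E} :
    z ∈ EP C f ↔ z ∈ C ∧ ∀ y ∈ C, f y z ≤ 0 := by
  refine and_congr_right fun hz => ⟨fun h y hy => ?_, fun h => ?_⟩
  · linarith [hf.monotone z hz y hy, h y hy]
  · simpa using hf.minty hs hco 0 0 hz (by simpa using h)

/-- The resolvent `T_r x` of a bifunction satisfying (A1)-(A4) exists. The regularized bifunction
is strongly monotone, so that the dual inequalities can be solved with the additional term
`m ‖z - y‖ ^ 2`, `m > 0`, which makes their solution sets bounded. -/
theorem ConditionsA.exists_isResolvent [CompleteSpace E] (hs : UniformlySmooth E)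
    (hc : TwoUniformlyConvex E) {C : Set E} (hne : C.Nonempty) (hcl : IsClosed C)
    (hco : Convex ℝ C) {f : E → E → ℝ} (hf : ConditionsA C f) {r : ℝ} (hr : 0 < r) (x : E) :
    ∃ z, IsResolvent C f r x z := by
  obtain ⟨κ, hκ, hphi⟩ := hc.phi_bound
  obtain ⟨y₀, hy₀⟩ := hne
  set ρ := 1 / r with hρ
  have hρ0 : 0 < ρ := by positivity
  -- Small enough to be absorbed by the strong monotonicity of `ρ J`, see `hmono`.
  set m := ρ * κ / 2 with hm
  have hm0 : 0 < m := by positivity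
  set g : E → E → ℝ := fun y z => f y z + (ρ * (J y - J x) (z - y) + m * ‖z - y‖ ^ 2) with hg
  have hmono : ∀ y ∈ C, ∀ z ∈ C, g y z + g z y ≤ 0 := by
    intro y hy z hz
    have h1 := hf.monotone y hy z hz
    have h2 := phi_three_point y z y
    rw [phi_self] at h2
    have h3 := mul_le_mul_of_nonneg_left (hphi y z) hρ0.le
    have h4 := mul_le_mul_of_nonneg_left (hphi z y) hρ0.le
    have e1 : (J y - J x) (z - y) = -(J y - J x) (y - z) := by rw [← map_neg, neg_sub]
    have e2 : (J z - J x) (y - z) - (J y - J x) (y - z) = (J z - J y) (y - z) := by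
      simp only [sub_apply]; ring
    have e3 := congrArg (ρ * ·) e2
    simp only [hg, e1]
    rw [norm_sub_rev z y] at h4 ⊢
    rw [hm]
    have h5 : 0 ≤ ρ * κ * ‖y - z‖ ^ 2 := by positivity
    have h6 : ρ * (phi y z + phi z y + 2 * (J z - J y) (y - z)) = 0 := by rw [← h2, mul_zero]
    linarith
  have hsq : ∀ y : E, ConvexOn ℝ C fun z => m * ‖z - y‖ ^ 2 := by
    intro y
    have h1 : ConvexOn ℝ C fun z : E => ‖z - y‖ := by
      have := (convexOn_dist y hco)
      simpa only [dist_eq_norm] using this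
    exact (h1.pow (fun z _ => norm_nonneg _) 2).smul hm0.le
  have hlin : ∀ y : E, ConvexOn ℝ C fun z => ρ * (J y - J x) (z - y) := by
    intro y
    refine ⟨hco, fun u _ v _ c c' _ _ hcc => le_of_eq ?_⟩
    obtain rfl : c' = 1 - c := by linarith
    simp only [map_sub, map_add, map_smul, smul_eq_mul]
    ring
  have hconv : ∀ y ∈ C, ConvexOn ℝ C (g y) := fun y hy =>
    (hf.convex y hy).add ((hlin y).add (hsq y))
  have hlsc : ∀ y ∈ C, LowerSemicontinuousOn (g y) C := by
    intro y hy
    have h1 : Continuous fun z : E => ρ * (J y - J x) (z - y) + m * ‖z - y‖ ^ 2 := by fun_prop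
    exact (hf.lowerSemicontinuous y hy).add h1.continuousOn.lowerSemicontinuousOn
  obtain ⟨c, hc0, hc⟩ := exists_neg_linear_le (hf.convex y₀ hy₀) hy₀
    (hf.lowerSemicontinuous y₀ hy₀) (hf.diag y₀ hy₀)
  have hB : ∀ z ∈ C, g y₀ z ≤ 0 →
      ‖z‖ ≤ ‖y₀‖ + (1 + (1 + c + ρ * ‖J y₀ - J x‖) / m) := by
    intro z hz hgz
    set w := ‖z - y₀‖ with hw
    set b := c + ρ * ‖J y₀ - J x‖ with hb
    have hb0 : 0 < b := by positivity
    have h1 := hc z hz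
    have h2 : -(‖J y₀ - J x‖ * w) ≤ (J y₀ - J x) (z - y₀) := by
      rw [neg_le]
      exact (neg_le_abs _).trans ((J y₀ - J x).le_opNorm _)
    have h3 := mul_le_mul_of_nonneg_left h2 hρ0.le
    have h4 : m * w ^ 2 ≤ b * w + 1 := by
      simp only [hg] at hgz
      rw [hb]; linarith
    have h5 : w ≤ 1 + (1 + c + ρ * ‖J y₀ - J x‖) / m := by
      by_contra! hlt
      have h6 : (1 + b) / m < w - 1 := by rw [hb, ← add_assoc]; linarith
      rw [div_lt_iff₀ hm0] at h6
      have h7 : 1 < w := by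
        have : 0 < (1 + c + ρ * ‖J y₀ - J x‖) / m := by positivity
        linarith
      nlinarith
    have h8 : ‖z‖ ≤ ‖y₀‖ + w := by
      have := norm_add_le y₀ (z - y₀)
      rwa [add_sub_cancel] at this
    linarith
  obtain ⟨z, hz, hzg⟩ := TwoUniformlyConvex.exists_forall_nonpos ‹_› hcl hmono hconv hlsc hy₀ hB
  refine ⟨z, hz, hf.minty hs hco ρ x hz fun y hy => ?_⟩
  have h1 := hzg y hy
  have h2 : 0 ≤ m * ‖z - y‖ ^ 2 := by positivity
  simp only [hg] at h1
  linarith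

/-- The resolvent decreases the Lyapunov distance to the solutions of the equilibrium problem. -/
theorem IsResolvent.phi_le {C : Set E} {f : E → E → ℝ} (hf : ConditionsA C f) {r : ℝ} (hr : 0 < r)
    {x z p : E} (hz : IsResolvent C f r x z) (hp : p ∈ EP C f) : phi p z ≤ phi p x := by
  have h1 := hz.2 p hp.1
  have h2 := hf.monotone p hp.1 z hz.1
  have h3 := hp.2 z hz.1
  have h4 : 0 ≤ 1 / r * (J z - J x) (p - z) := by linarith
  have h5 := nonneg_of_mul_nonneg_right h4 (by positivity)
  have h6 := phi_nonneg z x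
  rw [phi_three_point p z x]
  linarith

end Equilibrium

/-! ### Convexity and closedness of the solution sets -/

section FixedPoints

variable {E : Type*} [NormedAddCommGroup E]

theorem UniformlyLipschitz.continuousOn {C : Set E} {L : ℝ} {S : E → E}
    (h : UniformlyLipschitz C L S) : ContinuousOn S C := by
  intro x hx
  rw [ContinuousWithinAt, tendsto_iff_norm_sub_tendsto_zero]
  have h1 : Tendsto (fun y => L * ‖y - x‖) (𝓝[C] x) (𝓝 0) := by
    have : Continuous fun y => L * ‖y - x‖ := by fun_prop
    simpa using (this.tendsto x).mono_left nhdsWithin_le_nhds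
  refine squeeze_zero' (Eventually.of_forall fun _ => norm_nonneg _) ?_ h1
  filter_upwards [self_mem_nhdsWithin] with y hy
  exact h 1 le_rfl y hy x hx

/-- A point whose orbit returns to it in the limit is a fixed point. -/
theorem mem_Fix_of_tendsto {C : Set E} {S : E → E} (hSC : Set.MapsTo S C C)
    (hS : ContinuousOn S C) {p : E} (hp : p ∈ C)
    (h : Tendsto (fun n => S^[n] p) atTop (𝓝 p)) : p ∈ Fix C S := by
  refine ⟨hp, ?_⟩
  have h1 : Tendsto (fun n => S^[n] p) atTop (𝓝[C] p) :=
    tendsto_nhdsWithin_iff.2 ⟨h, Eventually.of_forall fun n => hSC.iterate n hp⟩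
  have h2 := (hS p hp).tendsto.comp h1
  have h3 := (tendsto_add_atTop_iff_nat 1).2 h
  simp only [Function.iterate_succ_apply'] at h3
  exact tendsto_nhds_unique h2 h3

theorem UniformlyLipschitz.isClosed_Fix {C : Set E} (hcl : IsClosed C) {L : ℝ} {S : E → E}
    (h : UniformlyLipschitz C L S) : IsClosed (Fix C S) := by
  have e : Fix C S = C ∩ (fun x => S x - x) ⁻¹' {0} := by
    ext p
    simp [Fix, sub_eq_zero]
  rw [e]
  exact (h.continuousOn.sub continuousOn_id).preimage_isClosed_of_isClosed hcl isClosed_singleton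

end FixedPoints

section SolutionSets

variable {E : Type*} [NormedAddCommGroup E] [NormedSpace ℝ E]

/-- Condition (V3) with `y = u` forces the solutions of the variational inequality to be zeros of
`A`. -/
theorem ConditionsV.mem_VI_iff {C : Set E} {α : ℝ} {A : E → (E →L[ℝ] ℝ)} (h : ConditionsV C α A)
    {p : E} : p ∈ VI C A ↔ p ∈ C ∧ A p = 0 := by
  refine ⟨fun hp => ⟨hp.1, ?_⟩, fun hp => ⟨hp.1, fun q _ => by simp [hp.2]⟩⟩
  have := h.norm_le p hp.1 p hp
  rwa [sub_self, norm_zero, norm_le_zero_iff] at this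

theorem ConditionsV.norm_sub_le {C : Set E} {α : ℝ} {A : E → (E →L[ℝ] ℝ)} (h : ConditionsV C α A)
    (hα : 0 < α) {x y : E} (hx : x ∈ C) (hy : y ∈ C) : ‖A x - A y‖ ≤ α⁻¹ * ‖x - y‖ := by
  have h1 := h.inverseStronglyMonotone x hx y hy
  have h2 := (le_abs_self _).trans ((A x - A y).le_opNorm (x - y))
  rw [inv_mul_eq_div, le_div_iff₀ hα]
  rcases (norm_nonneg (A x - A y)).eq_or_lt with h0 | h0
  · rw [← h0, zero_mul]; exact norm_nonneg _
  · nlinarith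

theorem ConditionsV.continuousOn {C : Set E} {α : ℝ} {A : E → (E →L[ℝ] ℝ)}
    (h : ConditionsV C α A) (hα : 0 < α) : ContinuousOn A C := by
  intro x hx
  rw [ContinuousWithinAt, tendsto_iff_norm_sub_tendsto_zero]
  have h1 : Tendsto (fun y => α⁻¹ * ‖y - x‖) (𝓝[C] x) (𝓝 0) := by
    have : Continuous fun y => α⁻¹ * ‖y - x‖ := by fun_prop
    simpa using (this.tendsto x).mono_left nhdsWithin_le_nhds
  refine squeeze_zero' (Eventually.of_forall fun _ => norm_nonneg _) ?_ h1
  filter_upwards [self_mem_nhdsWithin] with y hy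
  exact h.norm_sub_le hα hy hx

theorem ConditionsV.isClosed_VI {C : Set E} (hcl : IsClosed C) {α : ℝ} {A : E → (E →L[ℝ] ℝ)}
    (h : ConditionsV C α A) (hα : 0 < α) : IsClosed (VI C A) := by
  have e : VI C A = C ∩ A ⁻¹' {0} := by
    ext p; exact h.mem_VI_iff
  rw [e]
  exact (h.continuousOn hα).preimage_isClosed_of_isClosed hcl isClosed_singleton

theorem ConditionsV.convex_VI {C : Set E} (hco : Convex ℝ C) {α : ℝ} {A : E → (E →L[ℝ] ℝ)}
    (h : ConditionsV C α A) (hα : 0 < α) : Convex ℝ (VI C A) := by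
  intro p hp q hq s t hs ht hst
  rw [h.mem_VI_iff] at hp hq ⊢
  have hm := hco hp.1 hq.1 hs ht hst
  refine ⟨hm, ?_⟩
  set m := s • p + t • q with hmdef
  have h1 := mul_le_mul_of_nonneg_left (h.inverseStronglyMonotone m hm p hp.1) hs
  have h2 := mul_le_mul_of_nonneg_left (h.inverseStronglyMonotone m hm q hq.1) ht
  rw [hp.2, sub_zero] at h1
  rw [hq.2, sub_zero] at h2
  have e : s • (m - p) + t • (m - q) = 0 := by
    obtain rfl : t = 1 - s := by linarith
    rw [hmdef]; module
  have h3 := congrArg (A m) e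
  rw [map_add, map_smul, map_smul, map_zero, smul_eq_mul, smul_eq_mul] at h3
  have h4 : α * ‖A m‖ ^ 2 ≤ 0 := by
    have : (s + t) * (α * ‖A m‖ ^ 2) ≤ 0 := by linarith
    rwa [hst, one_mul] at this
  have h5 : ‖A m‖ ^ 2 ≤ 0 := by
    by_contra! hlt
    have := mul_pos hα hlt
    linarith
  exact norm_eq_zero.1 (pow_eq_zero_iff two_ne_zero |>.1 (le_antisymm h5 (sq_nonneg _)))

/-- For `n = 0` the inequality holds because `k 0 ≥ 1`. -/
theorem QuasiPhiAsympNonexpansive.phi_iterate_le {C : Set E} {k : ℕ → ℝ} {S : E → E}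
    (h : QuasiPhiAsympNonexpansive C k S) {p x : E} (hp : p ∈ Fix C S) (hx : x ∈ C) (n : ℕ) :
    phi p (S^[n] x) ≤ k n * phi p x := by
  rcases Nat.eq_zero_or_pos n with rfl | hn
  · have := mul_le_mul_of_nonneg_right (h.one_le 0) (phi_nonneg p x)
    rwa [one_mul] at this
  · exact h.phi_le n hn p hp x hx

theorem phi_convexCombination (p q w : E) {s t : ℝ} (hst : s + t = 1) :
    phi (s • p + t • q) w = s * phi p w + t * phi q w
      - (s * ‖p‖ ^ 2 + t * ‖q‖ ^ 2 - ‖s • p + t • q‖ ^ 2) := by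
  obtain rfl : t = 1 - s := by linarith
  simp only [phi, map_add, map_smul, smul_eq_mul]
  ring

/-- If `m` is a convex combination of fixed points, then `φ(m, Sⁿ m) ≤ (k_n - 1) v` with `v` the
defect of convexity of `‖·‖ ^ 2`, so that `Sⁿ m → m`. -/
theorem QuasiPhiAsympNonexpansive.convex_Fix (hc : TwoUniformlyConvex E) {C : Set E}
    (hco : Convex ℝ C) {k : ℕ → ℝ} {S : E → E} (h : QuasiPhiAsympNonexpansive C k S)
    (hSC : Set.MapsTo S C C) (hS : ContinuousOn S C) : Convex ℝ (Fix C S) := by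
  intro p hp q hq s t hs ht hst
  have hm := hco hp.1 hq.1 hs ht hst
  set m := s • p + t • q with hmdef
  set v := s * ‖p‖ ^ 2 + t * ‖q‖ ^ 2 - ‖m‖ ^ 2 with hv
  have hle : ∀ n, phi m (S^[n] m) ≤ (k n - 1) * v := by
    intro n
    have h1 := mul_le_mul_of_nonneg_left (h.phi_iterate_le hp hm n) hs
    have h2 := mul_le_mul_of_nonneg_left (h.phi_iterate_le hq hm n) ht
    have h3 := phi_convexCombination p q (S^[n] m) hst
    have h4 := phi_convexCombination p q m hst
    rw [← hmdef, ← hv] at h3 h4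
    rw [phi_self] at h4
    linear_combination h1 + h2 + h3 - k n * h4
  have hlim : Tendsto (fun n => (k n - 1) * v) atTop (𝓝 0) := by
    simpa using (h.tendsto_one.sub_const 1).mul_const v
  have h1 := hc.tendsto_sub_of_phi (x := fun _ => m) (y := fun n => S^[n] m)
    (squeeze_zero (fun n => phi_nonneg _ _) hle hlim)
  refine mem_Fix_of_tendsto hSC hS hm ?_
  have h2 := h1.const_sub m
  simpa using h2

theorem ConditionsA.isClosed_EP (hs : UniformlySmooth E) {C : Set E} (hcl : IsClosed C)
    (hco : Convex ℝ C) {f : E → E → ℝ} (hf : ConditionsA C f) : IsClosed (EP C f) := by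
  rw [← isSeqClosed_iff_isClosed]
  intro u p hu hup
  have hp : p ∈ C := hcl.mem_of_tendsto hup (Eventually.of_forall fun n => (hu n).1)
  refine (hf.mem_EP_iff hs hco).2 ⟨hp, fun y hy => ?_⟩
  by_contra! hlt
  have h1 : Tendsto u atTop (𝓝[C] p) :=
    tendsto_nhdsWithin_iff.2 ⟨hup, Eventually.of_forall fun n => (hu n).1⟩
  obtain ⟨n, hn⟩ := (h1.eventually (hf.lowerSemicontinuous y hy p hp 0 hlt)).exists
  exact absurd hn (not_lt.2 (((hf.mem_EP_iff hs hco).1 (hu n)).2 y hy))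

theorem ConditionsA.convex_EP (hs : UniformlySmooth E) {C : Set E} (hco : Convex ℝ C)
    {f : E → E → ℝ} (hf : ConditionsA C f) : Convex ℝ (EP C f) := by
  intro p hp q hq s t hs' ht hst
  rw [hf.mem_EP_iff hs hco] at hp hq ⊢
  refine ⟨hco hp.1 hq.1 hs' ht hst, fun y hy => ?_⟩
  have := (hf.convex y hy).2 hp.1 hq.1 hs' ht hst
  simp only [smul_eq_mul] at this
  have h1 := mul_nonpos_of_nonneg_of_nonpos hs' (hp.2 y hy)
  have h2 := mul_nonpos_of_nonneg_of_nonpos ht (hq.2 y hy)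
  linarith

end SolutionSets

/-! ### The Lyapunov estimates of one step -/

section Step

variable {E : Type*} [NormedAddCommGroup E] [NormedSpace ℝ E]

/-- The quadratic terms in `v` cancel: the set is a half-space. -/
theorem setOf_phi_le_eq (u z : E) (ε : ℝ) :
    {v | phi v u ≤ phi v z + ε} = {v | (2 • (J z - J u)) v ≤ ‖z‖ ^ 2 - ‖u‖ ^ 2 + ε} := by
  ext v
  simp only [Set.mem_ofPred_eq, phi, two_smul, add_apply, sub_apply]
  constructor <;> intro h <;> linarith

theorem isClosed_setOf_phi_le (u z : E) (ε : ℝ) : IsClosed {v | phi v u ≤ phi v z + ε} := by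
  rw [setOf_phi_le_eq]
  exact isClosed_le (by fun_prop) continuous_const

theorem convex_setOf_phi_le (u z : E) (ε : ℝ) : Convex ℝ {v | phi v u ≤ phi v z + ε} := by
  rw [setOf_phi_le_eq]
  exact convex_halfSpace_le (2 • (J z - J u)).isLinear _

/-- The Lyapunov estimate for one projected gradient step. -/
theorem ConditionsV.phi_proj_le (hs : UniformlySmooth E) (hc : TwoUniformlyConvex E) {C : Set E}
    (hco : Convex ℝ C) {α : ℝ} {A : E → (E →L[ℝ] ℝ)} (h : ConditionsV C α A)
    {a b lam : ℝ} (ha : 0 < a) (hb : b < α * bestC E ^ 2 / 2) (hlam : lam ∈ Set.Icc a b)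
    {p x w y : E} (hp : p ∈ VI C A) (hx : x ∈ C) (hw : J w = J x - lam • A x)
    (hy : IsGenProj C w y) :
    phi p y ≤ phi p x - 2 * a * (α - 2 / bestC E ^ 2 * b) * ‖A x‖ ^ 2 := by
  obtain ⟨⟨hc0, -, hcb⟩, -⟩ := hc.bestC_isGreatest
  set c := bestC E with hcdef
  set D := 2 / c ^ 2 with hD
  have hD0 : 0 < D := by positivity
  have hlam0 : 0 < lam := ha.trans_le hlam.1
  have hη : 0 < α - D * b := by
    have : D * b < α := by
      rw [hD, div_mul_eq_mul_div, div_lt_iff₀ (by positivity)]; linarith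
    linarith
  have h1 := hy.phi_add_le hs hco hp.1
  have h2 := phi_three_point p w x
  have h3 := h.inverseStronglyMonotone x hx p hp.1
  rw [(h.mem_VI_iff.1 hp).2, sub_zero] at h3
  have h4 : ‖w - x‖ ≤ D * (lam * ‖A x‖) := by
    refine (hcb w x).trans_eq ?_
    rw [hw, sub_sub_cancel_left, norm_neg, norm_smul, Real.norm_of_nonneg hlam0.le]
  have h5 : A x (x - w) ≤ ‖A x‖ * ‖w - x‖ := by
    rw [norm_sub_rev]
    exact (le_abs_self _).trans ((A x).le_opNorm _)
  have h6 : (J w - J x) (p - w) = lam * (A x (x - p) - A x (x - w)) := by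
    rw [hw, sub_sub_cancel_left, neg_apply, smul_apply, smul_eq_mul, map_sub, map_sub, map_sub]
    ring
  have h7 : A x (x - w) ≤ D * lam * ‖A x‖ ^ 2 := by
    have := mul_le_mul_of_nonneg_left h4 (norm_nonneg (A x))
    linarith
  have h8 : lam * ((α - D * lam) * ‖A x‖ ^ 2) ≤ (J w - J x) (p - w) := by
    rw [h6]
    refine mul_le_mul_of_nonneg_left ?_ hlam0.le
    linarith
  have h9 : a * (α - D * b) ≤ lam * (α - D * lam) := by
    have : D * lam ≤ D * b := mul_le_mul_of_nonneg_left hlam.2 hD0.le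
    exact mul_le_mul hlam.1 (by linarith) hη.le hlam0.le
  have h10 := mul_le_mul_of_nonneg_right h9 (sq_nonneg ‖A x‖)
  have h11 := phi_nonneg w x
  have h12 := phi_nonneg y w
  linarith

/-- `φ(p, ·)` is convex in the dual variable. -/
theorem phi_le_of_J_convexCombination {p x s z : E} {t : ℝ} (ht0 : 0 ≤ t) (ht1 : t ≤ 1)
    (hz : J z = t • J x + (1 - t) • J s) : phi p z ≤ t * phi p x + (1 - t) * phi p s := by
  have h1 : ‖z‖ ≤ t * ‖x‖ + (1 - t) * ‖s‖ := by
    rw [← norm_J z, hz]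
    refine (norm_add_le _ _).trans_eq ?_
    rw [norm_smul, norm_smul, norm_J, norm_J, Real.norm_of_nonneg ht0,
      Real.norm_of_nonneg (sub_nonneg.2 ht1)]
  have h2 : ‖z‖ ^ 2 ≤ (t * ‖x‖ + (1 - t) * ‖s‖) ^ 2 := pow_le_pow_left₀ (norm_nonneg _) h1 2
  have h3 : 0 ≤ t * (1 - t) * (‖x‖ - ‖s‖) ^ 2 :=
    mul_nonneg (mul_nonneg ht0 (sub_nonneg.2 ht1)) (sq_nonneg _)
  simp only [phi, hz, add_apply, smul_apply, smul_eq_mul]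
  linarith

end Step

/-! ### Existence of runs of the iteration -/

section Iteration

variable {E : Type*} [NormedAddCommGroup E] [NormedSpace ℝ E] {M N K : ℕ}

/-- The standing hypotheses on the space, on the three families of problems and on the parameters
of the iteration. -/
structure Hypotheses (C : Set E) (α : ℝ) (A : Fin M → E → (E →L[ℝ] ℝ)) (S : Fin N → E → E)
    (f : Fin K → E → E → ℝ) (L : ℝ) (k : ℕ → ℝ) (ω : ℝ) (al lam r : ℕ → ℝ) (a b d : ℝ) :
    Prop where
  smooth : UniformlySmooth E
  convex : TwoUniformlyConvex E
  isClosed_C : IsClosed C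
  convex_C : Convex ℝ C
  α_pos : 0 < α
  condA : ∀ i, ConditionsV C α (A i)
  condf : ∀ l, ConditionsA C (f l)
  mapsTo : ∀ j, Set.MapsTo (S j) C C
  lipschitz : ∀ j, UniformlyLipschitz C L (S j)
  quasi : ∀ j, QuasiPhiAsympNonexpansive C k (S j)
  nonempty : (commonSolutions C A S f).Nonempty
  norm_le : ∀ p ∈ commonSolutions C A S f, ‖p‖ ≤ ω
  al_mem : ∀ n, 0 ≤ al n ∧ al n ≤ 1
  limsup_al : limsup al atTop < 1
  a_pos : 0 < a
  b_lt : b < α * bestC E ^ 2 / 2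
  lam_mem : ∀ n, lam n ∈ Set.Icc a b
  d_pos : 0 < d
  d_le : ∀ n, d ≤ r n

/-- The relation between the iterate `x = x_n` and the auxiliary points, with the selected indices,
that the `n`-th step of the iteration computes from it. -/
structure IsStep (C : Set E) (A : Fin M → E → (E →L[ℝ] ℝ)) (S : Fin N → E → E)
    (f : Fin K → E → E → ℝ) (al lam r : ℕ → ℝ) (n : ℕ) (x : E) (y : Fin M → E) (iBar : Fin M)
    (z : Fin N → E) (jBar : Fin N) (u : Fin K → E) (kBar : Fin K) : Prop where
  y_spec : ∀ i, ∃ w : E, J w = J x - lam n • A i x ∧ IsGenProj C w (y i)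
  iBar_spec : ∀ i, ‖y i - x‖ ≤ ‖y iBar - x‖
  z_spec : ∀ j, J (z j) = al n • J x + (1 - al n) • J ((S j)^[n] (y iBar))
  jBar_spec : ∀ j, ‖z j - x‖ ≤ ‖z jBar - x‖
  u_spec : ∀ l, IsResolvent C (f l) (r n) (z jBar) (u l)
  kBar_spec : ∀ l, ‖u l - x‖ ≤ ‖u kBar - x‖

/-- The set `C_{n+1}` cut out of `D = C_n` by the points `u = ū_n`, `z = z̄_n`, `x = x_n` and the
tolerance `ε = ε_n`. -/
def cutSet (D : Set E) (u z x : E) (ε : ℝ) : Set E :=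
  {v | v ∈ D ∧ phi v u ≤ phi v z ∧ phi v z ≤ phi v x + ε}

theorem cutSet_eq (D : Set E) (u z x : E) (ε : ℝ) : cutSet D u z x ε =
    D ∩ ({v | phi v u ≤ phi v z + 0} ∩ {v | phi v z ≤ phi v x + ε}) := by
  simp only [add_zero]; rfl

variable {C : Set E} {α : ℝ} {A : Fin M → E → (E →L[ℝ] ℝ)} {S : Fin N → E → E}
  {f : Fin K → E → E → ℝ} {L : ℝ} {k : ℕ → ℝ} {ω : ℝ} {al lam r : ℕ → ℝ} {a b d : ℝ}

theorem mem_commonSolutions {p : E} : p ∈ commonSolutions C A S f ↔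
    (∀ i, p ∈ VI C (A i)) ∧ (∀ j, p ∈ Fix C (S j)) ∧ ∀ l, p ∈ EP C (f l) := by
  simp only [commonSolutions, Set.mem_inter_iff, Set.mem_iInter, and_assoc]

theorem commonSolutions_subset (hM : 1 ≤ M) : commonSolutions C A S f ⊆ C :=
  fun _ hp => ((mem_commonSolutions.1 hp).1 ⟨0, hM⟩).1

namespace Hypotheses

theorem isClosed_commonSolutions (H : Hypotheses C α A S f L k ω al lam r a b d) :
    IsClosed (commonSolutions C A S f) :=
  ((isClosed_iInter fun i => (H.condA i).isClosed_VI H.isClosed_C H.α_pos).inter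
    (isClosed_iInter fun j => (H.lipschitz j).isClosed_Fix H.isClosed_C)).inter
    (isClosed_iInter fun l => (H.condf l).isClosed_EP H.smooth H.isClosed_C H.convex_C)

theorem convex_commonSolutions (H : Hypotheses C α A S f L k ω al lam r a b d) :
    Convex ℝ (commonSolutions C A S f) :=
  ((convex_iInter fun i => (H.condA i).convex_VI H.convex_C H.α_pos).inter
    (convex_iInter fun j => (H.quasi j).convex_Fix H.convex H.convex_C (H.mapsTo j)
      (H.lipschitz j).continuousOn)).inter
    (convex_iInter fun l => (H.condf l).convex_EP H.smooth H.convex_C)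

theorem lam_pos (H : Hypotheses C α A S f L k ω al lam r a b d) (n : ℕ) : 0 < lam n :=
  H.a_pos.trans_le (H.lam_mem n).1

theorem r_pos (H : Hypotheses C α A S f L k ω al lam r a b d) (n : ℕ) : 0 < r n :=
  H.d_pos.trans_le (H.d_le n)

theorem bestC_pos (H : Hypotheses C α A S f L k ω al lam r a b d) : 0 < bestC E :=
  H.convex.bestC_isGreatest.1.1

theorem norm_sub_le (H : Hypotheses C α A S f L k ω al lam r a b d) (x y : E) :
    ‖x - y‖ ≤ 2 / bestC E ^ 2 * ‖J x - J y‖ :=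
  H.convex.bestC_isGreatest.1.2.2 x y

/-- The step length restriction makes the gradient step a strict descent step away from the
zeros of `A`. -/
theorem descent_pos (H : Hypotheses C α A S f L k ω al lam r a b d) :
    0 < 2 * a * (α - 2 / bestC E ^ 2 * b) := by
  have hc := H.bestC_pos
  have h1 : 2 / bestC E ^ 2 * b < α := by
    rw [div_mul_eq_mul_div, div_lt_iff₀ (by positivity)]
    linarith [H.b_lt]
  have := H.a_pos
  have h2 := sub_pos.2 h1
  positivity

end Hypotheses

namespace IsStep

variable {n : ℕ} {x : E} {y : Fin M → E} {iBar : Fin M} {z : Fin N → E} {jBar : Fin N}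
  {u : Fin K → E} {kBar : Fin K}

theorem y_mem (T : IsStep C A S f al lam r n x y iBar z jBar u kBar) (i : Fin M) : y i ∈ C :=
  let ⟨_, _, hw⟩ := T.y_spec i
  hw.1

theorem phi_u_le (T : IsStep C A S f al lam r n x y iBar z jBar u kBar)
    (H : Hypotheses C α A S f L k ω al lam r a b d) {p : E} (hp : p ∈ commonSolutions C A S f) :
    phi p (u kBar) ≤ phi p (z jBar) :=
  (T.u_spec kBar).phi_le (H.condf kBar) (H.r_pos n) ((mem_commonSolutions.1 hp).2.2 kBar)

theorem phi_z_le (T : IsStep C A S f al lam r n x y iBar z jBar u kBar)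
    (H : Hypotheses C α A S f L k ω al lam r a b d) (hx : x ∈ C) {p : E}
    (hp : p ∈ commonSolutions C A S f) :
    phi p (z jBar) ≤ phi p x + (k n - 1) * (ω + ‖x‖) ^ 2
      - (1 - al n) * (2 * a * (α - 2 / bestC E ^ 2 * b) * ‖A iBar x‖ ^ 2) := by
  obtain ⟨hpV, hpS, -⟩ := mem_commonSolutions.1 hp
  obtain ⟨w, hw, hy⟩ := T.y_spec iBar
  set η := 2 * a * (α - 2 / bestC E ^ 2 * b) with hη
  have hη0 : 0 < η := H.descent_pos
  obtain ⟨hal0, hal1⟩ := H.al_mem n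
  have hk : 1 ≤ k n := (H.quasi jBar).one_le n
  have h1 := (H.condA iBar).phi_proj_le H.smooth H.convex H.convex_C H.a_pos H.b_lt (H.lam_mem n)
    (hpV iBar) hx hw hy
  rw [← hη] at h1
  have h2 := (H.quasi jBar).phi_iterate_le (hpS jBar) (T.y_mem iBar) n
  have h3 := phi_le_of_J_convexCombination (p := p) hal0 hal1 (T.z_spec jBar)
  have h4 : phi p x ≤ (ω + ‖x‖) ^ 2 := by
    refine (phi_le_sq_norm_add_norm p x).trans ?_
    exact pow_le_pow_left₀ (by positivity) (by linarith [H.norm_le p hp]) 2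
  have hal1' : 0 ≤ 1 - al n := sub_nonneg.2 hal1
  have hk' : 0 ≤ k n - 1 := sub_nonneg.2 hk
  have h5 := mul_le_mul_of_nonneg_left (h2.trans
    (mul_le_mul_of_nonneg_left h1 (zero_le_one.trans hk))) hal1'
  have h6 : 0 ≤ (1 - al n) * ((k n - 1) * (η * ‖A iBar x‖ ^ 2)) := by positivity
  have h7 := mul_le_mul_of_nonneg_left h4 hk'
  have h8 : 0 ≤ al n * ((k n - 1) * phi p x) :=
    mul_nonneg hal0 (mul_nonneg hk' (phi_nonneg p x))
  linarith

theorem commonSolutions_subset_cutSet (T : IsStep C A S f al lam r n x y iBar z jBar u kBar)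
    (H : Hypotheses C α A S f L k ω al lam r a b d) (hx : x ∈ C) {D : Set E}
    (hD : commonSolutions C A S f ⊆ D) :
    commonSolutions C A S f ⊆
      cutSet D (u kBar) (z jBar) x ((k n - 1) * (ω + ‖x‖) ^ 2) := by
  intro p hp
  refine ⟨hD hp, T.phi_u_le H hp, (T.phi_z_le H hx hp).trans ?_⟩
  have h1 := H.descent_pos
  have h2 := sub_nonneg.2 (H.al_mem n).2
  have : 0 ≤ (1 - al n) * (2 * a * (α - 2 / bestC E ^ 2 * b) * ‖A iBar x‖ ^ 2) := by positivity
  linarith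

end IsStep

theorem Hypotheses.exists_isStep [CompleteSpace E]
    (H : Hypotheses C α A S f L k ω al lam r a b d) (hM : 1 ≤ M) (hN : 1 ≤ N) (hK : 1 ≤ K)
    (hC : C.Nonempty) (n : ℕ) (x : E) :
    ∃ (y : Fin M → E) (iBar : Fin M) (z : Fin N → E) (jBar : Fin N) (u : Fin K → E) (kBar : Fin K),
      IsStep C A S f al lam r n x y iBar z jBar u kBar := by
  have : Nonempty (Fin M) := ⟨⟨0, hM⟩⟩
  have : Nonempty (Fin N) := ⟨⟨0, hN⟩⟩
  have : Nonempty (Fin K) := ⟨⟨0, hK⟩⟩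
  have hJ := J_surjective H.smooth H.convex
  choose w hw using fun i => hJ (J x - lam n • A i x)
  choose y hy using fun i => H.convex.exists_isGenProj hC H.isClosed_C H.convex_C (w i)
  obtain ⟨iBar, hi⟩ := Finite.exists_max fun i => ‖y i - x‖
  choose z hz using fun j => hJ (al n • J x + (1 - al n) • J ((S j)^[n] (y iBar)))
  obtain ⟨jBar, hj⟩ := Finite.exists_max fun j => ‖z j - x‖
  choose u hu using fun l => (H.condf l).exists_isResolvent H.smooth H.convex hC H.isClosed_C
    H.convex_C (H.r_pos n) (z jBar)
  obtain ⟨kBar, hl⟩ := Finite.exists_max fun l => ‖u l - x‖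
  exact ⟨y, iBar, z, jBar, u, kBar, fun i => ⟨w i, hw i, hy i⟩, hi, hz, hj, hu, hl⟩

theorem isClosed_cutSet {D : Set E} (hD : IsClosed D) (u z x : E) (ε : ℝ) :
    IsClosed (cutSet D u z x ε) := by
  rw [cutSet_eq]
  exact hD.inter ((isClosed_setOf_phi_le _ _ _).inter (isClosed_setOf_phi_le _ _ _))

theorem convex_cutSet {D : Set E} (hD : Convex ℝ D) (u z x : E) (ε : ℝ) :
    Convex ℝ (cutSet D u z x ε) := by
  rw [cutSet_eq]
  exact hD.inter ((convex_setOf_phi_le _ _ _).inter (convex_setOf_phi_le _ _ _))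

/-- The properties of the pair `(x_n, C_n)` that the iteration preserves. -/
structure IsState (C F : Set E) (s : E × Set E) : Prop where
  mem : s.1 ∈ s.2
  isClosed : IsClosed s.2
  convex : Convex ℝ s.2
  subset : s.2 ⊆ C
  solutions_subset : F ⊆ s.2

theorem IsState.next (H : Hypotheses C α A S f L k ω al lam r a b d) {s : E × Set E}
    (hs : IsState C (commonSolutions C A S f) s) {n : ℕ} {y : Fin M → E} {iBar : Fin M}
    {z : Fin N → E} {jBar : Fin N} {u : Fin K → E} {kBar : Fin K}
    (T : IsStep C A S f al lam r n s.1 y iBar z jBar u kBar) {x₀ x' : E}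
    (hx' : IsGenProj (cutSet s.2 (u kBar) (z jBar) s.1 ((k n - 1) * (ω + ‖s.1‖) ^ 2)) x₀ x') :
    IsState C (commonSolutions C A S f)
      (x', cutSet s.2 (u kBar) (z jBar) s.1 ((k n - 1) * (ω + ‖s.1‖) ^ 2)) where
  mem := hx'.1
  isClosed := isClosed_cutSet hs.isClosed _ _ _ _
  convex := convex_cutSet hs.convex _ _ _ _
  subset := fun _ hv => hs.subset hv.1
  solutions_subset := T.commonSolutions_subset_cutSet H (hs.subset hs.mem) hs.solutions_subset

/-- The run is built by recursion on the pair `(x_n, C_n)`. -/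
theorem Hypotheses.nonempty_methodA [CompleteSpace E]
    (H : Hypotheses C α A S f L k ω al lam r a b d) (hM : 1 ≤ M) (hN : 1 ≤ N) (hK : 1 ≤ K)
    {x₀ : E} (hx₀ : x₀ ∈ C) : Nonempty (MethodA C A S f k ω al lam r x₀) := by
  choose y iBar z jBar u kBar T using fun (n : ℕ) (s : E × Set E) =>
    H.exists_isStep hM hN hK ⟨x₀, hx₀⟩ n s.1
  set D' : ℕ → E × Set E → Set E := fun n s =>
    cutSet s.2 (u n s (kBar n s)) (z n s (jBar n s)) s.1 ((k n - 1) * (ω + ‖s.1‖) ^ 2) with hD'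
  have hex : ∀ n s, ∃ x', IsState C (commonSolutions C A S f) s → IsGenProj (D' n s) x₀ x' := by
    intro n s
    by_cases hs : IsState C (commonSolutions C A S f) s
    · have hsub := (T n s).commonSolutions_subset_cutSet H (hs.subset hs.mem) hs.solutions_subset
      obtain ⟨x', hx'⟩ := H.convex.exists_isGenProj (H.nonempty.mono hsub)
        (isClosed_cutSet hs.isClosed _ _ _ _) (convex_cutSet hs.convex _ _ _ _) x₀
      exact ⟨x', fun _ => hx'⟩
    · exact ⟨x₀, fun h => absurd h hs⟩
  choose x' hx' using hex
  let s : ℕ → E × Set E := fun n => n.rec (x₀, C) fun n s => (x' n s, D' n s)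
  have hs : ∀ n, IsState C (commonSolutions C A S f) (s n) := by
    intro n
    induction n with
    | zero =>
      exact ⟨hx₀, H.isClosed_C, H.convex_C, subset_rfl, commonSolutions_subset hM⟩
    | succ n ih => exact ih.next H (T n (s n)) (hx' n (s n) ih)
  exact ⟨{
    x := fun n => (s n).1
    y := fun n => y n (s n)
    iBar := fun n => iBar n (s n)
    z := fun n => z n (s n)
    jBar := fun n => jBar n (s n)
    u := fun n => u n (s n)
    kBar := fun n => kBar n (s n)
    D := fun n => (s n).2
    x_zero := rfl
    D_zero := rfl
    y_spec := fun n => (T n (s n)).y_spec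
    iBar_spec := fun n => (T n (s n)).iBar_spec
    z_spec := fun n => (T n (s n)).z_spec
    jBar_spec := fun n => (T n (s n)).jBar_spec
    u_spec := fun n => (T n (s n)).u_spec
    kBar_spec := fun n => (T n (s n)).kBar_spec
    D_succ := fun n => rfl
    x_succ := fun n => hx' n (s n) (hs n) }⟩

end Iteration

/-! ### Convergence of the iteration -/

section Convergence

variable {E : Type*} [NormedAddCommGroup E] [NormedSpace ℝ E] {M N K : ℕ}
  {C : Set E} {α : ℝ} {A : Fin M → E → (E →L[ℝ] ℝ)} {S : Fin N → E → E}
  {f : Fin K → E → E → ℝ} {L : ℝ} {k : ℕ → ℝ} {ω : ℝ} {al lam r : ℕ → ℝ} {a b d : ℝ} {x₀ : E}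

theorem tendsto_clm_apply {ι : Type*} {l : Filter ι} {ξ : ι → E →L[ℝ] ℝ} {v : ι → E}
    {ξ₀ : E →L[ℝ] ℝ} {q : E} (hξ : Tendsto ξ l (𝓝 ξ₀)) (hv : Tendsto v l (𝓝 q)) :
    Tendsto (fun n => ξ n (v n)) l (𝓝 (ξ₀ q)) := by
  have hc : Continuous fun w : (E →L[ℝ] ℝ) × E => w.1 w.2 := by fun_prop
  exact (hc.tendsto (ξ₀, q)).comp (hξ.prodMk_nhds hv)

theorem UniformlySmooth.tendsto_phi (h : UniformlySmooth E) {ι : Type*} {l : Filter ι}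
    {x y : ι → E} {p q : E} (hx : Tendsto x l (𝓝 p)) (hy : Tendsto y l (𝓝 q)) :
    Tendsto (fun n => phi (x n) (y n)) l (𝓝 (phi p q)) :=
  ((hx.norm.pow 2).sub ((tendsto_clm_apply ((h.continuous_J.tendsto q).comp hy) hx).const_mul
    2)).add (hy.norm.pow 2)

theorem tendsto_of_norm_sub_le {G : Type*} [NormedAddCommGroup G] {x v w : ℕ → G} {p : G}
    (hx : Tendsto x atTop (𝓝 p)) (hw : Tendsto w atTop (𝓝 p))
    (h : ∀ n, ‖v n - x n‖ ≤ ‖w n - x n‖) : Tendsto v atTop (𝓝 p) := by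
  have h1 : Tendsto (fun n => ‖w n - x n‖) atTop (𝓝 0) := by simpa using (hw.sub hx).norm
  have h2 := (squeeze_zero_norm h h1).add hx
  simpa using h2

namespace MethodA

theorem isStep (R : MethodA C A S f k ω al lam r x₀) (n : ℕ) :
    IsStep C A S f al lam r n (R.x n) (R.y n) (R.iBar n) (R.z n) (R.jBar n) (R.u n) (R.kBar n) :=
  ⟨R.y_spec n, R.iBar_spec n, R.z_spec n, R.jBar_spec n, R.u_spec n, R.kBar_spec n⟩

theorem isState (R : MethodA C A S f k ω al lam r x₀)
    (H : Hypotheses C α A S f L k ω al lam r a b d) (hM : 1 ≤ M) (hx₀ : x₀ ∈ C) (n : ℕ) :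
    IsState C (commonSolutions C A S f) (R.x n, R.D n) := by
  induction n with
  | zero =>
    rw [R.x_zero, R.D_zero]
    exact ⟨hx₀, H.isClosed_C, H.convex_C, subset_rfl, commonSolutions_subset hM⟩
  | succ n ih =>
    have h1 := R.x_succ n
    have h2 : R.D (n + 1) = cutSet (R.D n) (R.u n (R.kBar n)) (R.z n (R.jBar n)) (R.x n)
        ((k n - 1) * (ω + ‖R.x n‖) ^ 2) := R.D_succ n
    rw [h2] at h1 ⊢
    exact ih.next H (R.isStep n) h1

theorem isGenProj (R : MethodA C A S f k ω al lam r x₀) (hx₀ : x₀ ∈ C) (n : ℕ) :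
    IsGenProj (R.D n) x₀ (R.x n) := by
  cases n with
  | zero =>
    rw [R.x_zero, R.D_zero]
    exact ⟨hx₀, fun y _ => by rw [phi_self]; exact phi_nonneg _ _⟩
  | succ n => exact R.x_succ n

theorem D_antitone (R : MethodA C A S f k ω al lam r x₀) : Antitone R.D :=
  antitone_nat_of_succ_le fun n v hv => by
    rw [R.D_succ n] at hv
    exact hv.1

/-- The iterates form a Cauchy sequence, because `φ(x_n, x₀)` is increasing, bounded by
`φ(q, x₀)` for every common solution `q`, and `φ(x_m, x_n) ≤ φ(x_m, x₀) - φ(x_n, x₀)` for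
`n ≤ m`. -/
theorem cauchySeq (R : MethodA C A S f k ω al lam r x₀)
    (H : Hypotheses C α A S f L k ω al lam r a b d) (hM : 1 ≤ M) (hx₀ : x₀ ∈ C) :
    CauchySeq R.x := by
  obtain ⟨κ, hκ, hphi⟩ := H.convex.phi_bound
  obtain ⟨q, hq⟩ := H.nonempty
  have hadd : ∀ n m, n ≤ m → phi (R.x m) (R.x n) + phi (R.x n) x₀ ≤ phi (R.x m) x₀ :=
    fun n m hnm => (R.isGenProj hx₀ n).phi_add_le H.smooth (R.isState H hM hx₀ n).convex
      (R.D_antitone hnm (R.isGenProj hx₀ m).1)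
  have hmono : Monotone fun n => phi (R.x n) x₀ := fun n m hnm => by
    have h1 := hadd n m hnm
    have h2 := phi_nonneg (R.x m) (R.x n)
    linarith
  have hbdd : BddAbove (Set.range fun n => phi (R.x n) x₀) := by
    refine ⟨phi q x₀, ?_⟩
    rintro _ ⟨n, rfl⟩
    exact (R.isGenProj hx₀ n).2 q ((R.isState H hM hx₀ n).solutions_subset hq)
  rw [Metric.cauchySeq_iff']
  intro ε hε
  have h1 := (tendsto_atTop_ciSup hmono hbdd).eventually_const_lt
    (show (⨆ n, phi (R.x n) x₀) - κ * ε ^ 2 < ⨆ n, phi (R.x n) x₀ by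
      have : 0 < κ * ε ^ 2 := by positivity
      linarith)
  obtain ⟨n₀, hn₀⟩ := eventually_atTop.1 h1
  refine ⟨n₀, fun m hm => ?_⟩
  have h2 := hn₀ n₀ le_rfl
  have h3 := le_ciSup hbdd m
  have h4 := hadd n₀ m hm
  have h5 := hphi (R.x m) (R.x n₀)
  rw [dist_eq_norm]
  refine lt_of_pow_lt_pow_left₀ 2 hε.le (lt_of_mul_lt_mul_left ?_ hκ.le)
  linarith

variable {p : E}

theorem tendsto_tolerance (R : MethodA C A S f k ω al lam r x₀)
    (H : Hypotheses C α A S f L k ω al lam r a b d) (hN : 1 ≤ N)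
    (hp : Tendsto R.x atTop (𝓝 p)) :
    Tendsto (fun n => (k n - 1) * (ω + ‖R.x n‖) ^ 2) atTop (𝓝 0) := by
  have h1 := ((H.quasi ⟨0, hN⟩).tendsto_one.sub_const 1).mul ((hp.norm.const_add ω).pow 2)
  simpa using h1

/-- Since `x_{n+1} ∈ C_{n+1}`, the points `z̄_n` are close to `x_{n+1}`. -/
theorem tendsto_zBar (R : MethodA C A S f k ω al lam r x₀)
    (H : Hypotheses C α A S f L k ω al lam r a b d) (hN : 1 ≤ N)
    (hp : Tendsto R.x atTop (𝓝 p)) : Tendsto (fun n => R.z n (R.jBar n)) atTop (𝓝 p) := by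
  have hp1 : Tendsto (fun n => R.x (n + 1)) atTop (𝓝 p) := (tendsto_add_atTop_iff_nat 1).2 hp
  have h0 : Tendsto (fun n => phi (R.x (n + 1)) (R.x n) + (k n - 1) * (ω + ‖R.x n‖) ^ 2) atTop
      (𝓝 0) := by
    have := (H.smooth.tendsto_phi hp1 hp).add (R.tendsto_tolerance H hN hp)
    rwa [phi_self, add_zero] at this
  have hmem : ∀ n, _ := fun n => (R.D_succ n).subset (R.x_succ n).1
  have h1 := H.convex.tendsto_sub_of_phi
    (squeeze_zero (fun n => phi_nonneg _ _) (fun n => (hmem n).2.2) h0)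
  simpa using hp1.sub h1

theorem tendsto_z (R : MethodA C A S f k ω al lam r x₀)
    (H : Hypotheses C α A S f L k ω al lam r a b d) (hN : 1 ≤ N)
    (hp : Tendsto R.x atTop (𝓝 p)) (j : Fin N) : Tendsto (fun n => R.z n j) atTop (𝓝 p) :=
  tendsto_of_norm_sub_le hp (R.tendsto_zBar H hN hp) fun n => R.jBar_spec n j

theorem tendsto_u (R : MethodA C A S f k ω al lam r x₀)
    (H : Hypotheses C α A S f L k ω al lam r a b d) (hN : 1 ≤ N)
    (hp : Tendsto R.x atTop (𝓝 p)) (l : Fin K) : Tendsto (fun n => R.u n l) atTop (𝓝 p) := by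
  have hp1 : Tendsto (fun n => R.x (n + 1)) atTop (𝓝 p) := (tendsto_add_atTop_iff_nat 1).2 hp
  have h0 := H.smooth.tendsto_phi hp1 (R.tendsto_zBar H hN hp)
  rw [phi_self] at h0
  have hmem : ∀ n, _ := fun n => (R.D_succ n).subset (R.x_succ n).1
  have h1 := H.convex.tendsto_sub_of_phi
    (squeeze_zero (fun n => phi_nonneg _ _) (fun n => (hmem n).2.1) h0)
  have h2 : Tendsto (fun n => R.u n (R.kBar n)) atTop (𝓝 p) := by
    simpa using hp1.sub h1
  exact tendsto_of_norm_sub_le hp h2 fun n => R.kBar_spec n l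

end MethodA

theorem Hypotheses.exists_al_le (H : Hypotheses C α A S f L k ω al lam r a b d) :
    ∃ δ : ℝ, 0 < δ ∧ ∀ᶠ n in atTop, δ ≤ 1 - al n := by
  obtain ⟨γ, h1, h2⟩ := exists_between H.limsup_al
  refine ⟨1 - γ, sub_pos.2 h2, ?_⟩
  have hb : IsBoundedUnder (· ≤ ·) atTop al := isBoundedUnder_of ⟨1, fun n => (H.al_mem n).2⟩
  filter_upwards [eventually_lt_of_limsup_lt h1 hb] with n hn
  linarith

namespace MethodA

variable {p : E}

/-- The decrease of the Lyapunov distance to a common solution tends to zero, which forces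
`A_{i_n} x_n → 0` along the selected indices. -/
theorem tendsto_norm_A_iBar (R : MethodA C A S f k ω al lam r x₀)
    (H : Hypotheses C α A S f L k ω al lam r a b d) (hM : 1 ≤ M) (hN : 1 ≤ N) (hx₀ : x₀ ∈ C)
    (hp : Tendsto R.x atTop (𝓝 p)) :
    Tendsto (fun n => ‖A (R.iBar n) (R.x n)‖) atTop (𝓝 0) := by
  obtain ⟨q, hq⟩ := H.nonempty
  obtain ⟨δ, hδ, hal⟩ := H.exists_al_le
  have hη := H.descent_pos
  set η := 2 * a * (α - 2 / bestC E ^ 2 * b) with hηdef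
  have h1 : Tendsto (fun n => (phi q (R.x n) + (k n - 1) * (ω + ‖R.x n‖) ^ 2
      - phi q (R.z n (R.jBar n))) / (δ * η)) atTop (𝓝 0) := by
    have := (((H.smooth.tendsto_phi (tendsto_const_nhds (x := q)) hp).add
      (R.tendsto_tolerance H hN hp)).sub (H.smooth.tendsto_phi (tendsto_const_nhds (x := q))
      (R.tendsto_zBar H hN hp))).div_const (δ * η)
    simpa using this
  have h2 : Tendsto (fun n => ‖A (R.iBar n) (R.x n)‖ ^ 2) atTop (𝓝 0) := by
    refine squeeze_zero' (Eventually.of_forall fun n => sq_nonneg _) ?_ h1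
    filter_upwards [hal] with n hn
    have hst := R.isState H hM hx₀ n
    have h3 := (R.isStep n).phi_z_le H (hst.subset hst.mem) hq
    rw [← hηdef] at h3
    have h4 := mul_le_mul_of_nonneg_right hn
      (show 0 ≤ η * ‖A (R.iBar n) (R.x n)‖ ^ 2 by positivity)
    rw [le_div_iff₀ (by positivity)]
    linarith
  have h3 := h2.sqrt
  simpa [Real.sqrt_sq] using h3

/-- Both `w_n = J⁻¹ (J x_n - λ_n A_{i_n} x_n)` and its projection `ȳ_n` are close to
`x_n ∈ C`. -/
theorem tendsto_yBar (R : MethodA C A S f k ω al lam r x₀)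
    (H : Hypotheses C α A S f L k ω al lam r a b d) (hM : 1 ≤ M) (hN : 1 ≤ N) (hx₀ : x₀ ∈ C)
    (hp : Tendsto R.x atTop (𝓝 p)) :
    Tendsto (fun n => R.y n (R.iBar n)) atTop (𝓝 p) := by
  have hA := R.tendsto_norm_A_iBar H hM hN hx₀ hp
  choose w hw hproj using fun n => R.y_spec n (R.iBar n)
  have hwx : Tendsto (fun n => w n - R.x n) atTop (𝓝 0) := by
    have h1 : Tendsto (fun n => 2 / bestC E ^ 2 * (b * ‖A (R.iBar n) (R.x n)‖)) atTop (𝓝 0) := by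
      simpa using (hA.const_mul b).const_mul (2 / bestC E ^ 2)
    refine squeeze_zero_norm (fun n => (H.norm_sub_le _ _).trans ?_) h1
    rw [hw, sub_sub_cancel_left, norm_neg, norm_smul, Real.norm_of_nonneg (H.lam_pos n).le]
    have := (H.lam_mem n).2
    gcongr
  have hwp : Tendsto w atTop (𝓝 p) := by simpa using hwx.add hp
  have hphi := H.smooth.tendsto_phi hp hwp
  rw [phi_self] at hphi
  have hle : ∀ n, phi (R.x n) (R.y n (R.iBar n)) ≤ phi (R.x n) (w n) := by
    intro n
    have hst := R.isState H hM hx₀ n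
    have h1 := (hproj n).phi_add_le H.smooth H.convex_C (hst.subset hst.mem)
    have h2 := phi_nonneg (R.y n (R.iBar n)) (w n)
    linarith
  have h1 := H.convex.tendsto_sub_of_phi (squeeze_zero (fun n => phi_nonneg _ _) hle hphi)
  simpa using hp.sub h1

theorem tendsto_y (R : MethodA C A S f k ω al lam r x₀)
    (H : Hypotheses C α A S f L k ω al lam r a b d) (hM : 1 ≤ M) (hN : 1 ≤ N) (hx₀ : x₀ ∈ C)
    (hp : Tendsto R.x atTop (𝓝 p)) (i : Fin M) : Tendsto (fun n => R.y n i) atTop (𝓝 p) :=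
  tendsto_of_norm_sub_le hp (R.tendsto_yBar H hM hN hx₀ hp) fun n => R.iBar_spec n i

theorem limit_mem (R : MethodA C A S f k ω al lam r x₀)
    (H : Hypotheses C α A S f L k ω al lam r a b d) (hM : 1 ≤ M) (hx₀ : x₀ ∈ C)
    (hp : Tendsto R.x atTop (𝓝 p)) : p ∈ C :=
  H.isClosed_C.mem_of_tendsto hp (Eventually.of_forall fun n =>
    (R.isState H hM hx₀ n).subset (R.isState H hM hx₀ n).mem)

/-- The variational inequality of the projection `y_n^i`, divided by `λ_n ≥ a`, passes to the
limit. -/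
theorem limit_mem_VI (R : MethodA C A S f k ω al lam r x₀)
    (H : Hypotheses C α A S f L k ω al lam r a b d) (hM : 1 ≤ M) (hN : 1 ≤ N) (hx₀ : x₀ ∈ C)
    (hp : Tendsto R.x atTop (𝓝 p)) (i : Fin M) : p ∈ VI C (A i) := by
  have hpC := R.limit_mem H hM hx₀ hp
  refine ⟨hpC, fun q hq => ?_⟩
  have hy := R.tendsto_y H hM hN hx₀ hp i
  have hJ := H.smooth.continuous_J
  have hxC : ∀ n, R.x n ∈ C := fun n =>
    (R.isState H hM hx₀ n).subset (R.isState H hM hx₀ n).mem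
  have hAx : Tendsto (fun n => A i (R.x n)) atTop (𝓝 (A i p)) :=
    ((H.condA i).continuousOn H.α_pos p hpC).tendsto.comp
      (tendsto_nhdsWithin_iff.2 ⟨hp, Eventually.of_forall hxC⟩)
  have hq' : Tendsto (fun n => q - R.y n i) atTop (𝓝 (q - p)) := hy.const_sub q
  have hT : Tendsto (fun n => A i (R.x n) (q - R.y n i)) atTop (𝓝 (A i p (q - p))) :=
    tendsto_clm_apply hAx hq'
  have hs : Tendsto (fun n => -(|(J (R.y n i) - J (R.x n)) (q - R.y n i)| / a)) atTop (𝓝 0) := by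
    have h1 := tendsto_clm_apply (((hJ.tendsto p).comp hy).sub ((hJ.tendsto p).comp hp)) hq'
    simpa using (h1.abs.div_const a).neg
  refine le_of_tendsto_of_tendsto' hs hT fun n => ?_
  obtain ⟨w, hw, hproj⟩ := R.y_spec n i
  have h1 := hproj.variational H.smooth H.convex_C hq
  have e : J (R.y n i) - J w = (J (R.y n i) - J (R.x n)) + lam n • A i (R.x n) := by
    rw [hw]; abel
  rw [e, add_apply, smul_apply, smul_eq_mul] at h1
  set t := A i (R.x n) (q - R.y n i)
  set s := (J (R.y n i) - J (R.x n)) (q - R.y n i)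
  have h2 := le_abs_self s
  have hla := (H.lam_mem n).1
  have hl0 := H.lam_pos n
  rw [neg_le, le_div_iff₀ H.a_pos]
  rcases le_or_gt 0 t with ht | ht
  · have := mul_nonneg ht H.a_pos.le
    linarith [abs_nonneg s]
  · have := mul_le_mul_of_nonneg_left hla (neg_pos.2 ht).le
    linarith

/-- As `α_n` stays away from `1`, the convergence `z_n^j → p` carries over to `S_j^n ȳ_n`, and by
the uniform Lipschitz condition to `S_j^n p`. -/
theorem limit_mem_Fix (R : MethodA C A S f k ω al lam r x₀)
    (H : Hypotheses C α A S f L k ω al lam r a b d) (hM : 1 ≤ M) (hN : 1 ≤ N) (hx₀ : x₀ ∈ C)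
    (hp : Tendsto R.x atTop (𝓝 p)) (j : Fin N) : p ∈ Fix C (S j) := by
  have hpC := R.limit_mem H hM hx₀ hp
  have hJ := H.smooth.continuous_J
  obtain ⟨δ, hδ, hal⟩ := H.exists_al_le
  have hc := H.bestC_pos
  set s : ℕ → E := fun n => (S j)^[n] (R.y n (R.iBar n)) with hs
  have hyBar := R.tendsto_yBar H hM hN hx₀ hp
  have hsx : Tendsto (fun n => s n - R.x n) atTop (𝓝 0) := by
    have h1 : Tendsto (fun n => 2 / bestC E ^ 2 * (‖J (R.z n j) - J (R.x n)‖ / δ)) atTop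
        (𝓝 0) := by
      have h2 := (((hJ.tendsto p).comp (R.tendsto_z H hN hp j)).sub ((hJ.tendsto p).comp hp)).norm
      simpa using (h2.div_const δ).const_mul (2 / bestC E ^ 2)
    refine squeeze_zero_norm' ?_ h1
    filter_upwards [hal] with n hn
    refine (H.norm_sub_le _ _).trans ?_
    refine mul_le_mul_of_nonneg_left ?_ (by positivity)
    have e : J (R.z n j) - J (R.x n) = (1 - al n) • (J (s n) - J (R.x n)) := by
      rw [R.z_spec n j]; module
    rw [le_div_iff₀ hδ, e, norm_smul, Real.norm_of_nonneg (hδ.le.trans hn), mul_comm]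
    exact mul_le_mul_of_nonneg_right hn (norm_nonneg _)
  have hsp : Tendsto s atTop (𝓝 p) := by simpa using hsx.add hp
  refine mem_Fix_of_tendsto (H.mapsTo j) (H.lipschitz j).continuousOn hpC ?_
  have h1 : Tendsto (fun n => (S j)^[n] p - s n) atTop (𝓝 0) := by
    have h2 : Tendsto (fun n => L * ‖p - R.y n (R.iBar n)‖) atTop (𝓝 0) := by
      simpa using (hyBar.const_sub p).norm.const_mul L
    refine squeeze_zero_norm' ?_ h2
    filter_upwards [eventually_ge_atTop 1] with n hn
    exact H.lipschitz j n hn p hpC _ ((R.isStep n).y_mem _)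
  simpa using h1.add hsp

/-- By monotonicity `f_l(y, u_n^l)` is bounded above by the regularizing term, which vanishes in
the limit since `r_n ≥ d`. -/
theorem limit_mem_EP (R : MethodA C A S f k ω al lam r x₀)
    (H : Hypotheses C α A S f L k ω al lam r a b d) (hM : 1 ≤ M) (hN : 1 ≤ N) (hx₀ : x₀ ∈ C)
    (hp : Tendsto R.x atTop (𝓝 p)) (l : Fin K) : p ∈ EP C (f l) := by
  have hpC := R.limit_mem H hM hx₀ hp
  have hJ := H.smooth.continuous_J
  have hu := R.tendsto_u H hN hp l
  refine ((H.condf l).mem_EP_iff H.smooth H.convex_C).2 ⟨hpC, fun y hy => ?_⟩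
  by_contra! hlt
  have huC : Tendsto (fun n => R.u n l) atTop (𝓝[C] p) :=
    tendsto_nhdsWithin_iff.2 ⟨hu, Eventually.of_forall fun n => (R.u_spec n l).1⟩
  have h1 : Tendsto (fun n => |(J (R.u n l) - J (R.z n (R.jBar n))) (y - R.u n l)| / d) atTop
      (𝓝 0) := by
    have h2 := tendsto_clm_apply (((hJ.tendsto p).comp hu).sub
      ((hJ.tendsto p).comp (R.tendsto_zBar H hN hp))) (hu.const_sub y)
    simpa using h2.abs.div_const d
  have h2 := huC.eventually ((H.condf l).lowerSemicontinuous y hy p hpC _ (half_lt_self hlt))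
  have h3 := h1.eventually_lt_const (half_pos hlt)
  obtain ⟨n, hn2, hn3⟩ := (h2.and h3).exists
  have h4 := (R.u_spec n l).2 y hy
  have h5 := (H.condf l).monotone y hy _ (R.u_spec n l).1
  set t := (J (R.u n l) - J (R.z n (R.jBar n))) (y - R.u n l)
  have h6 : 1 / r n * t ≤ |t| / d := by
    rw [one_div_mul_eq_div]
    exact (div_le_div_of_nonneg_right (le_abs_self t) (H.r_pos n).le).trans
      (div_le_div_of_nonneg_left (abs_nonneg t) H.d_pos (H.d_le n))
  linarith

theorem isGenProj_limit (R : MethodA C A S f k ω al lam r x₀)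
    (H : Hypotheses C α A S f L k ω al lam r a b d) (hM : 1 ≤ M) (hN : 1 ≤ N) (hx₀ : x₀ ∈ C)
    (hp : Tendsto R.x atTop (𝓝 p)) : IsGenProj (commonSolutions C A S f) x₀ p := by
  refine ⟨mem_commonSolutions.2 ⟨R.limit_mem_VI H hM hN hx₀ hp, R.limit_mem_Fix H hM hN hx₀ hp,
    R.limit_mem_EP H hM hN hx₀ hp⟩, fun q hq => ?_⟩
  refine le_of_tendsto' (H.smooth.tendsto_phi hp tendsto_const_nhds) fun n => ?_
  exact (R.isGenProj hx₀ n).2 q ((R.isState H hM hx₀ n).solutions_subset hq)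

end MethodA

end Convergence

end HybridMethod

theorem theorem3p1 {E : Type*} [NormedAddCommGroup E] [NormedSpace ℝ E] [CompleteSpace E]
    (hsmooth : HybridMethod.UniformlySmooth E) (hconv : HybridMethod.TwoUniformlyConvex E)
    (C : Set E) (hCne : C.Nonempty) (hCcl : IsClosed C) (hCco : Convex ℝ C)
    {M N K : ℕ} (hM : 1 ≤ M) (hN : 1 ≤ N) (hK : 1 ≤ K)
    (α : ℝ) (hα : 0 < α)
    (A : Fin M → E → (E →L[ℝ] ℝ)) (hA : ∀ i, HybridMethod.ConditionsV C α (A i))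
    (f : Fin K → E → E → ℝ) (hf : ∀ l, HybridMethod.ConditionsA C (f l))
    (S : Fin N → E → E) (hSC : ∀ j, Set.MapsTo (S j) C C)
    (L : ℝ) (hL : 0 < L) (hSL : ∀ j, HybridMethod.UniformlyLipschitz C L (S j))
    (k : ℕ → ℝ) (hS : ∀ j, HybridMethod.QuasiPhiAsympNonexpansive C k (S j))
    (hF : (HybridMethod.commonSolutions C A S f).Nonempty)
    (ω : ℝ) (hω : 0 < ω) (hFω : ∀ p ∈ HybridMethod.commonSolutions C A S f, ‖p‖ ≤ ω)
    (al lam r : ℕ → ℝ)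
    (hal : ∀ n, 0 ≤ al n ∧ al n ≤ 1) (hal' : limsup al atTop < 1)
    (a b : ℝ) (ha : a ∈ Set.Ioo 0 (α * HybridMethod.bestC E ^ 2 / 2))
    (hb : b ∈ Set.Ioo 0 (α * HybridMethod.bestC E ^ 2 / 2))
    (hlam : ∀ n, lam n ∈ Set.Icc a b)
    (d : ℝ) (hd : 0 < d) (hr : ∀ n, d ≤ r n)
    (x₀ : E) (hx₀ : x₀ ∈ C) :
    -- the iteration can be carried out
    Nonempty (HybridMethod.MethodA C A S f k ω al lam r x₀) ∧
    -- `p = Π_F x₀` is well defined, and every run of the iteration converges strongly to it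
    ∃ p : E, (∀ q, HybridMethod.IsGenProj (HybridMethod.commonSolutions C A S f) x₀ q ↔ q = p) ∧
      ∀ R : HybridMethod.MethodA C A S f k ω al lam r x₀, Tendsto R.x atTop (𝓝 p) := by
  have H : HybridMethod.Hypotheses C α A S f L k ω al lam r a b d :=
    ⟨hsmooth, hconv, hCcl, hCco, hα, hA, hf, hSC, hSL, hS, hF, hFω, hal, hal', ha.1, hb.2, hlam,
      hd, hr⟩
  refine ⟨H.nonempty_methodA hM hN hK hx₀, ?_⟩
  obtain ⟨p, hp⟩ := hconv.exists_isGenProj hF H.isClosed_commonSolutions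
    H.convex_commonSolutions x₀
  refine ⟨p, fun q => ⟨fun hq => hq.unique hsmooth hconv H.convex_commonSolutions hp,
    fun hq => hq ▸ hp⟩, fun R => ?_⟩
  obtain ⟨q, hq⟩ := cauchySeq_tendsto_of_complete (R.cauchySeq H hM hx₀)
  rwa [(R.isGenProj_limit H hM hN hx₀ hq).unique hsmooth hconv H.convex_commonSolutions hp] at hq
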